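/- Let $A$ be a real $n\times d$ matrix with rows $a_1^T,\dots,a_n^T$, with $d\ge 1$ and of full column rank $d$, and let $p\ge 2$. The $\ell_p$ Lewis weights of $A$ are the unique nonnegative weights $\bar w\in\mathbb{R}^n$ such that, with $\bar W=\operatorname{diag}(\bar w)$, the matrix $A^T\bar W^{1-2/p}A$ is invertible and $$a_i^T\left(A^T\bar W^{1-2/p}A\right)^{-1}a_i=\bar w_i^{2/p}\qquad (1\le i\le n).$$ The Lewis quadratic form $Q$ is the unique maximizer of $\det M$ over all symmetric positive semidefinite $d\times d$ matrices $M$ with $\sum_{i=1}^n (a_i^TMa_i)^{p/2}\le d$. For $\alpha\ge 1$ write $x\approx_\alpha y$ if $\frac1\alpha x\le y\le\alpha x$; for symmetric matrices the inequalities are in the Loewner order. Theorem. There exist a function $f(p,\varepsilon)$, a constant $C$, and a single program for the real RAM (exact real arithmetic; unit cost for arithmetic operations, comparisons, powers $x^y$ of a base $x\ge 0$, and memory accesses; no rounding of reals to integers) such that the following holds for every $p\ge 2$, every $\varepsilon>0$ and every real $n\times d$ matrix $A$ with $d\ge 1$ and $\operatorname{rank}A=d$. The Lewis weights $\bar w$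 and the Lewis quadratic form $Q$ of $A$ exist and are unique, and on input $(n,d,A,p,\varepsilon)$ the program halts after at most $$f(p,\varepsilon)\; n\,\max\{1,\log n\}\,\max\{1,\log\log n\}\; d^{C}$$ steps (where the last maximum is $1$ for $n=1$) and outputs a vector $w\in\mathbb{R}^n$ with $w_i\approx_{1+\varepsilon}\bar w_i$ for all $i$, and a symmetric matrix $M\in\mathbb{R}^{d\times d}$ with $M\approx_{1+\varepsilon}Q$. -/

import Mathlib

/-! ## Lewis weights and the Lewis quadratic form -/

namespace LewisWeights

open Matrix

/-- The multiplicative approximation `x ≈_α y` of real numbers: `x / α ≤ y ≤ α x`. -/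
def Approx (α x y : ℝ) : Prop :=
  (1 / α) * x ≤ y ∧ y ≤ α * x

/-- The multiplicative approximation `P ≈_α Q` of symmetric matrices in the Loewner order:
`P / α ⪯ Q ⪯ α P`. -/
def LoewnerApprox {d : ℕ} (α : ℝ) (P Q : Matrix (Fin d) (Fin d) ℝ) : Prop :=
  (Q - (1 / α) • P).PosSemidef ∧ (α • P - Q).PosSemidef

/-- The matrix `Aᵀ W ^ (1 - 2 / p) A`, where `W` is the diagonal matrix with diagonal `w`. -/
noncomputable def weightedGram {n d : ℕ} (A : Matrix (Fin n) (Fin d) ℝ) (p : ℝ) (w : Fin n → ℝ) :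
    Matrix (Fin d) (Fin d) ℝ :=
  Aᵀ * Matrix.diagonal (fun i => w i ^ (1 - 2 / p)) * A

/-- `w` satisfies the definition of the `ℓ_p` Lewis weights of `A`: the weights are nonnegative,
`Aᵀ W ^ (1 - 2 / p) A` is invertible and `aᵢᵀ (Aᵀ W ^ (1 - 2 / p) A)⁻¹ aᵢ = wᵢ ^ (2 / p)`
for every row `aᵢ` of `A`. -/
def IsLewisWeights {n d : ℕ} (A : Matrix (Fin n) (Fin d) ℝ) (p : ℝ) (w : Fin n → ℝ) : Prop :=
  (∀ i, 0 ≤ w i) ∧ IsUnit (weightedGram A p w).det ∧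
    ∀ i, A i ⬝ᵥ ((weightedGram A p w)⁻¹ *ᵥ A i) = w i ^ (2 / p)

/-- Feasibility of `M` for the determinant maximization program:
`M ⪰ 0` (in particular `M` is symmetric) and `∑ᵢ (aᵢᵀ M aᵢ) ^ (p / 2) ≤ d`. -/
def IsFeasible {n d : ℕ} (A : Matrix (Fin n) (Fin d) ℝ) (p : ℝ)
    (M : Matrix (Fin d) (Fin d) ℝ) : Prop :=
  M.PosSemidef ∧ ∑ i, (A i ⬝ᵥ (M *ᵥ A i)) ^ (p / 2) ≤ (d : ℝ)

/-- `Q` is the Lewis quadratic form: it maximizes the determinant over all feasible matrices. -/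
def IsLewisForm {n d : ℕ} (A : Matrix (Fin n) (Fin d) ℝ) (p : ℝ)
    (Q : Matrix (Fin d) (Fin d) ℝ) : Prop :=
  IsFeasible A p Q ∧ ∀ M, IsFeasible A p M → M.det ≤ Q.det

end LewisWeights

/-! ## Real RAM programs with a step count

A structured programming language for the unit-cost real RAM.  A program has finitely many
registers for natural numbers (counters and indices) and finitely many two-dimensional arrays of
real numbers, addressed by expressions in the natural number registers.  Arithmetic is exact. -/

namespace RealRAM

/-- The memory: natural number registers, and arrays of reals (array name, row, column). -/
structure State where
  nat : ℕ → ℕ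
  real : ℕ → ℕ → ℕ → ℝ

/-- Natural number expressions: constants, registers, sum and truncated difference. -/
inductive NExp where
  | const (k : ℕ) : NExp
  | reg (x : ℕ) : NExp
  | add (e₁ e₂ : NExp) : NExp
  | sub (e₁ e₂ : NExp) : NExp

/-- Real expressions: rational constants, conversion of natural numbers, array look-up,
the four arithmetic operations, and powers of a nonnegative base. There is no rounding of reals
to integers. -/
inductive RExp where
  | const (q : ℚ) : RExp
  | ofNat (e : NExp) : RExp
  | get (a : ℕ) (i j : NExp) : RExp
  | add (e₁ e₂ : RExp) : RExp
  | sub (e₁ e₂ : RExp) : RExp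
  | mul (e₁ e₂ : RExp) : RExp
  | div (e₁ e₂ : RExp) : RExp
  | pow (e₁ e₂ : RExp) : RExp

/-- Tests: comparisons of natural numbers and of reals, and their Boolean combinations. -/
inductive BExp where
  | natLe (e₁ e₂ : NExp) : BExp
  | realLe (e₁ e₂ : RExp) : BExp
  | neg (b : BExp) : BExp
  | conj (b₁ b₂ : BExp) : BExp

/-- Programs. `setNat x e` is the assignment `x := e` to a natural number register, and
`setReal a i j e` is the assignment `a[i, j] := e` to an array entry. -/
inductive Program where
  | skip : Program
  | setNat (x : ℕ) (e : NExp) : Program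
  | setReal (a : ℕ) (i j : NExp) (e : RExp) : Program
  | seq (P₁ P₂ : Program) : Program
  | cond (b : BExp) (P₁ P₂ : Program) : Program
  | loop (b : BExp) (P : Program) : Program

/-- The value of a natural number expression. -/
def NExp.eval (σ : State) : NExp → ℕ
  | .const k => k
  | .reg x => σ.nat x
  | .add e₁ e₂ => e₁.eval σ + e₂.eval σ
  | .sub e₁ e₂ => e₁.eval σ - e₂.eval σ

/-- The number of elementary operations in a natural number expression. -/
def NExp.cost : NExp → ℕ
  | .const _ => 1
  | .reg _ => 1
  | .add e₁ e₂ => e₁.cost + e₂.cost + 1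
  | .sub e₁ e₂ => e₁.cost + e₂.cost + 1

open Classical in
/-- The value of a real expression. Division by zero returns `0`, and so does a power with a
negative base. -/
noncomputable def RExp.eval (σ : State) : RExp → ℝ
  | .const q => (q : ℝ)
  | .ofNat e => (e.eval σ : ℝ)
  | .get a i j => σ.real a (i.eval σ) (j.eval σ)
  | .add e₁ e₂ => e₁.eval σ + e₂.eval σ
  | .sub e₁ e₂ => e₁.eval σ - e₂.eval σ
  | .mul e₁ e₂ => e₁.eval σ * e₂.eval σ
  | .div e₁ e₂ => e₁.eval σ / e₂.eval σ
  | .pow e₁ e₂ => if 0 ≤ e₁.eval σ then e₁.eval σ ^ e₂.eval σ else 0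

/-- The number of elementary operations in a real expression. -/
def RExp.cost : RExp → ℕ
  | .const _ => 1
  | .ofNat e => e.cost + 1
  | .get _ i j => i.cost + j.cost + 1
  | .add e₁ e₂ => e₁.cost + e₂.cost + 1
  | .sub e₁ e₂ => e₁.cost + e₂.cost + 1
  | .mul e₁ e₂ => e₁.cost + e₂.cost + 1
  | .div e₁ e₂ => e₁.cost + e₂.cost + 1
  | .pow e₁ e₂ => e₁.cost + e₂.cost + 1

/-- The truth value of a test. -/
def BExp.eval (σ : State) : BExp → Prop
  | .natLe e₁ e₂ => e₁.eval σ ≤ e₂.eval σ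
  | .realLe e₁ e₂ => e₁.eval σ ≤ e₂.eval σ
  | .neg b => ¬ b.eval σ
  | .conj b₁ b₂ => b₁.eval σ ∧ b₂.eval σ

/-- The number of elementary operations in a test. -/
def BExp.cost : BExp → ℕ
  | .natLe e₁ e₂ => e₁.cost + e₂.cost + 1
  | .realLe e₁ e₂ => e₁.cost + e₂.cost + 1
  | .neg b => b.cost + 1
  | .conj b₁ b₂ => b₁.cost + b₂.cost + 1

/-- Overwrite a natural number register. -/
def State.setNat (σ : State) (x k : ℕ) : State where
  nat := Function.update σ.nat x k
  real := σ.real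

/-- Overwrite an array entry. -/
noncomputable def State.setReal (σ : State) (a i j : ℕ) (v : ℝ) : State where
  nat := σ.nat
  real := Function.update σ.real a
    (Function.update (σ.real a) i (Function.update (σ.real a i) j v))

/-- `Runs P σ t τ`: started in the memory `σ`, the program `P` halts after `t` elementary steps
in the memory `τ`. Every evaluation of an expression or a test is charged its number of
operations, and every assignment and every branching is charged one more step. -/
inductive Runs : Program → State → ℕ → State → Prop where
  | skip (σ : State) : Runs .skip σ 1 σ
  | setNat (σ : State) (x : ℕ) (e : NExp) :
      Runs (.setNat x e) σ (e.cost + 1) (σ.setNat x (e.eval σ))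
  | setReal (σ : State) (a : ℕ) (i j : NExp) (e : RExp) :
      Runs (.setReal a i j e) σ (i.cost + j.cost + e.cost + 1)
        (σ.setReal a (i.eval σ) (j.eval σ) (e.eval σ))
  | seq {P₁ P₂ : Program} {σ₁ σ₂ σ₃ : State} {t₁ t₂ : ℕ} (h₁ : Runs P₁ σ₁ t₁ σ₂)
      (h₂ : Runs P₂ σ₂ t₂ σ₃) : Runs (.seq P₁ P₂) σ₁ (t₁ + t₂) σ₃
  | condTrue {b : BExp} {P₁ P₂ : Program} {σ τ : State} {t : ℕ} (hb : b.eval σ)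
      (h : Runs P₁ σ t τ) : Runs (.cond b P₁ P₂) σ (b.cost + 1 + t) τ
  | condFalse {b : BExp} {P₁ P₂ : Program} {σ τ : State} {t : ℕ} (hb : ¬ b.eval σ)
      (h : Runs P₂ σ t τ) : Runs (.cond b P₁ P₂) σ (b.cost + 1 + t) τ
  | loopTrue {b : BExp} {P : Program} {σ₁ σ₂ σ₃ : State} {t₁ t₂ : ℕ} (hb : b.eval σ₁)
      (h₁ : Runs P σ₁ t₁ σ₂) (h₂ : Runs (.loop b P) σ₂ t₂ σ₃) :
      Runs (.loop b P) σ₁ (b.cost + 1 + t₁ + t₂) σ₃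
  | loopFalse {b : BExp} {P : Program} {σ : State} (hb : ¬ b.eval σ) :
      Runs (.loop b P) σ (b.cost + 1) σ

/-- The initial memory for an `n × d` matrix `A` and real parameters `p`, `ε`: registers `0` and
`1` hold `n` and `d`, array `0` holds `A`, the entries `[0, 0]` of arrays `1` and `2` hold `p` and
`ε`, and everything else is zero. -/
noncomputable def input {n d : ℕ} (A : Matrix (Fin n) (Fin d) ℝ) (p ε : ℝ) : State where
  nat := fun x => if x = 0 then n else if x = 1 then d else 0
  real := fun a i j =>
    if a = 0 then (if h : i < n ∧ j < d then A ⟨i, h.1⟩ ⟨j, h.2⟩ else 0)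
    else if a = 1 ∧ i = 0 ∧ j = 0 then p
    else if a = 2 ∧ i = 0 ∧ j = 0 then ε
    else 0

/-- The output vector: column `0` of array `3`. -/
def outputVector (τ : State) (n : ℕ) : Fin n → ℝ :=
  fun i => τ.real 3 i 0

/-- The output matrix: array `4`. -/
def outputMatrix (τ : State) (d : ℕ) : Matrix (Fin d) (Fin d) ℝ :=
  Matrix.of fun i j => τ.real 4 i j

end RealRAM

/-!
Write `G(w) = Aᵀ W ^ (1 - 2 / p) A`. If `w` has total mass at most `d` and `M` is feasible, Young's
inequality gives the weak duality `tr (G(w) M) ≤ d`. The first-order condition at a maximizer `Q` of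
the determinant says that the weights `wᵢ = (aᵢᵀ Q aᵢ) ^ (p / 2)` satisfy `Q = G(w)⁻¹`, so they are
Lewis weights. Conversely, for any Lewis weights weak duality and AM-GM show that `G(w)⁻¹` is the
unique maximizer.

The same comparison gives approximations: `tr (P⁻¹ Q)` and `tr (P Q⁻¹)` both close to `d` force
`P` to be close to `Q` in the Loewner order. Iterate `wᵢ ↦ wᵢ ^ (1 - 2 / p) aᵢᵀ G(w)⁻¹ aᵢ` from
uniform weights, and let `v` be the average of the `wᵢ ^ (1 - 2 / p)` over `T` iterations. Since
`X ↦ log aᵀ X⁻¹ a` is convex, the logarithms of the ratios of consecutive weights telescope, and the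
Lewis equations hold for `v` up to an error of order `log n / T` in the exponent. So `T` of order
`d log n` suffices, with a factor depending on `p` and `ε`, and an iteration takes `O(n d³)` steps.
A positive definite matrix is inverted by one rank one correction per column, which needs neither
pivoting nor square roots.
-/

namespace LewisWeights

open Matrix

/-! ### Positive definite matrices -/

section PosDef

variable {m : Type*} [Fintype m]

theorem posSemidef_of_quad_nonneg {M : Matrix m m ℝ} (hM : Mᵀ = M) (h : ∀ x, 0 ≤ x ⬝ᵥ M *ᵥ x) :
    M.PosSemidef :=
  .of_dotProduct_mulVec_nonneg (by simpa [IsHermitian] using hM) (by simpa using h)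

theorem quad_nonneg {M : Matrix m m ℝ} (hM : M.PosSemidef) (x : m → ℝ) : 0 ≤ x ⬝ᵥ M *ᵥ x := by
  simpa using hM.dotProduct_mulVec_nonneg x

theorem quad_pos {M : Matrix m m ℝ} (hM : M.PosDef) {x : m → ℝ} (hx : x ≠ 0) :
    0 < x ⬝ᵥ M *ᵥ x := by
  simpa using hM.dotProduct_mulVec_pos hx

omit [Fintype m] in
theorem transpose_eq_of_posSemidef {M : Matrix m m ℝ} (hM : M.PosSemidef) : Mᵀ = M := by
  simpa [IsHermitian] using hM.isHermitian

theorem posSemidef_transpose_mul_diagonal_mul [DecidableEq m] {v : m → ℝ} (hv : 0 ≤ v)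
    (C : Matrix m m ℝ) : (Cᵀ * diagonal v * C).PosSemidef := by
  simpa using (PosSemidef.diagonal hv).conjTranspose_mul_mul_same C

variable [DecidableEq m]

theorem isUnit_det_of_posDef {M : Matrix m m ℝ} (hM : M.PosDef) : IsUnit M.det :=
  hM.det_pos.ne'.isUnit

open scoped MatrixOrder in
theorem exists_isUnit_transpose_mul_self {Q : Matrix m m ℝ} (hQ : Q.PosDef) :
    ∃ B : Matrix m m ℝ, IsUnit B ∧ Q = Bᵀ * B := by
  obtain ⟨B, hB⟩ := CStarAlgebra.nonneg_iff_eq_star_mul_self.mp hQ.posSemidef.nonneg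
  rw [star_eq_conjTranspose, conjTranspose_eq_transpose_of_trivial] at hB
  have hdet := isUnit_det_of_posDef hQ
  rw [hB, det_mul] at hdet
  exact ⟨B, (isUnit_iff_isUnit_det B).mpr (isUnit_of_mul_isUnit_right hdet), hB⟩

theorem exists_orthogonal_diagonal {M : Matrix m m ℝ} (hM : M.PosDef) :
    ∃ (U : Matrix m m ℝ) (μ : m → ℝ),
      Uᵀ * U = 1 ∧ U * Uᵀ = 1 ∧ (∀ i, 0 < μ i) ∧ M = U * diagonal μ * Uᵀ := by
  have hH := hM.isHermitian
  refine ⟨hH.eigenvectorUnitary, hH.eigenvalues, ?_, ?_, hM.eigenvalues_pos, ?_⟩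
  · simpa [star_eq_conjTranspose] using Unitary.coe_star_mul_self hH.eigenvectorUnitary
  · simpa [star_eq_conjTranspose] using Unitary.coe_mul_star_self hH.eigenvectorUnitary
  · conv_lhs => rw [hH.spectral_theorem]
    simp [Unitary.conjStarAlgAut_apply, star_eq_conjTranspose]

theorem exists_simultaneous_diagonal {P Q : Matrix m m ℝ} (hP : P.PosDef) (hQ : Q.PosDef) :
    ∃ (C : Matrix m m ℝ) (μ : m → ℝ),
      IsUnit C ∧ (∀ i, 0 < μ i) ∧ Q = Cᵀ * C ∧ P = Cᵀ * diagonal μ * C := by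
  obtain ⟨B, hB, rfl⟩ := exists_isUnit_transpose_mul_self hQ
  have hBdet := (isUnit_iff_isUnit_det B).mp hB
  have hY : (B⁻¹ᵀ * P * B⁻¹).PosDef := by
    simpa using hP.conjTranspose_mul_mul_same
      (mulVec_injective_of_isUnit (isUnit_nonsing_inv_iff.mpr hB))
  obtain ⟨U, μ, hU, hU', hμ, hdiag⟩ := exists_orthogonal_diagonal hY
  refine ⟨Uᵀ * B, μ, ?_, hμ, ?_, ?_⟩
  · exact (IsUnit.of_mul_eq_one U hU).mul hB
  · calc Bᵀ * B = Bᵀ * (U * Uᵀ) * B := by rw [hU', Matrix.mul_one]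
      _ = (Uᵀ * B)ᵀ * (Uᵀ * B) := by
        simp only [transpose_mul, transpose_transpose, Matrix.mul_assoc]
  · calc P = Bᵀ * (B⁻¹ᵀ * P * B⁻¹) * B := by
          rw [transpose_nonsing_inv, Matrix.mul_assoc Bᵀ⁻¹,
            mul_nonsing_inv_cancel_left _ _ (isUnit_det_transpose B hBdet),
            nonsing_inv_mul_cancel_right _ _ hBdet]
      _ = (Uᵀ * B)ᵀ * diagonal μ * (Uᵀ * B) := by
          rw [hdiag]; simp only [transpose_mul, transpose_transpose, Matrix.mul_assoc]

theorem add_inv_sub_two_eq {β : ℝ} (hβ : 0 < β) : β + β⁻¹ - 2 = (β - 1) ^ 2 / β := by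
  field_simp
  ring

theorem mem_Icc_of_add_inv_le {β μ : ℝ} (hβ : 1 ≤ β) (hμ : 0 < μ) (h : μ + μ⁻¹ ≤ β + β⁻¹) :
    μ ∈ Set.Icc β⁻¹ β := by
  have hβ0 : 0 < β := by linarith
  have hprod : (μ - β) * (μ * β - 1) ≤ 0 := by
    have : (μ - β) * (μ * β - 1) = (μ + μ⁻¹ - (β + β⁻¹)) * (μ * β) := by
      field_simp; ring
    rw [this]
    exact mul_nonpos_of_nonpos_of_nonneg (by linarith) (by positivity)
  rcases mul_nonpos_iff.mp hprod with ⟨h₁, h₂⟩ | ⟨h₁, h₂⟩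
  · exact ⟨(inv_le_one_of_one_le₀ hβ).trans (by linarith), by nlinarith⟩
  · exact ⟨(inv_le_iff_one_le_mul₀ hβ0).mpr (by linarith), by linarith⟩

theorem loewnerApprox_congr_diagonal {d : ℕ} {β : ℝ} (hβ : 0 < β) (C : Matrix (Fin d) (Fin d) ℝ)
    {μ : Fin d → ℝ} (hμ : ∀ i, μ i ∈ Set.Icc β⁻¹ β) :
    LoewnerApprox β (Cᵀ * diagonal μ * C) (Cᵀ * C) := by
  constructor
  · have hdiag : diagonal (fun i => 1 - β⁻¹ * μ i) = 1 - β⁻¹ • diagonal μ := by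
      rw [← diagonal_smul, ← diagonal_one, diagonal_sub]
      rfl
    have : Cᵀ * C - (1 / β) • (Cᵀ * diagonal μ * C) =
        Cᵀ * diagonal (fun i => 1 - β⁻¹ * μ i) * C := by
      simp only [hdiag, Matrix.mul_sub, Matrix.sub_mul, Matrix.mul_one, Matrix.mul_smul,
        Matrix.smul_mul, one_div]
    rw [this]
    refine posSemidef_transpose_mul_diagonal_mul (fun i => ?_) C
    simpa [inv_mul_le_one₀ hβ] using (hμ i).2
  · have hdiag : diagonal (fun i => β * μ i - 1) = β • diagonal μ - 1 := by
      rw [← diagonal_smul, ← diagonal_one, diagonal_sub]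
      rfl
    have : β • (Cᵀ * diagonal μ * C) - Cᵀ * C = Cᵀ * diagonal (fun i => β * μ i - 1) * C := by
      simp only [hdiag, Matrix.mul_sub, Matrix.sub_mul, Matrix.mul_one, Matrix.mul_smul,
        Matrix.smul_mul]
    rw [this]
    refine posSemidef_transpose_mul_diagonal_mul (fun i => ?_) C
    simpa [← inv_le_iff_one_le_mul₀' hβ] using (hμ i).1

theorem trace_inv_congr_diagonal_mul {C : Matrix m m ℝ} (hC : IsUnit C.det) {μ : m → ℝ}
    (hμ : ∀ i, μ i ≠ 0) : ((Cᵀ * diagonal μ * C)⁻¹ * (Cᵀ * C)).trace = ∑ i, (μ i)⁻¹ := by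
  have hdiag : (diagonal μ)⁻¹ = diagonal fun i => (μ i)⁻¹ := inv_eq_left_inv <| by
    simp [diagonal_mul_diagonal, fun i => inv_mul_cancel₀ (hμ i)]
  rw [Matrix.mul_inv_rev, Matrix.mul_inv_rev, hdiag, Matrix.mul_assoc, Matrix.mul_assoc,
    nonsing_inv_mul_cancel_left _ _ (isUnit_det_transpose C hC), Matrix.trace_mul_comm,
    mul_nonsing_inv_cancel_right _ _ hC, trace_diagonal]

theorem trace_congr_diagonal_mul_inv {C : Matrix m m ℝ} (hC : IsUnit C.det) (μ : m → ℝ) :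
    (Cᵀ * diagonal μ * C * (Cᵀ * C)⁻¹).trace = ∑ i, μ i := by
  rw [Matrix.mul_inv_rev, ← Matrix.mul_assoc, mul_nonsing_inv_cancel_right _ _ hC,
    Matrix.trace_mul_comm, nonsing_inv_mul_cancel_left _ _ (isUnit_det_transpose C hC),
    trace_diagonal]

theorem loewnerApprox_of_trace_add_trace_le {d : ℕ} {P Q : Matrix (Fin d) (Fin d) ℝ} {β : ℝ}
    (hP : P.PosDef) (hQ : Q.PosDef) (hβ : 1 ≤ β)
    (h : (P⁻¹ * Q).trace + (P * Q⁻¹).trace ≤ 2 * d + (β + β⁻¹ - 2)) : LoewnerApprox β P Q := by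
  obtain ⟨C, μ, hC, hμ, rfl, rfl⟩ := exists_simultaneous_diagonal hP hQ
  rw [isUnit_iff_isUnit_det] at hC
  rw [trace_inv_congr_diagonal_mul hC fun i => (hμ i).ne', trace_congr_diagonal_mul_inv hC] at h
  have hterm : ∀ i, 0 ≤ μ i + (μ i)⁻¹ - 2 := fun i => by
    rw [add_inv_sub_two_eq (hμ i)]
    exact div_nonneg (sq_nonneg _) (hμ i).le
  refine loewnerApprox_congr_diagonal (by linarith) C fun i => mem_Icc_of_add_inv_le hβ (hμ i) ?_
  have hle := Finset.single_le_sum (fun j _ => hterm j) (Finset.mem_univ i)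
  simp only [Finset.sum_sub_distrib, Finset.sum_add_distrib, Finset.sum_const,
    Finset.card_univ, Fintype.card_fin, nsmul_eq_mul] at hle
  linarith

open scoped MatrixOrder in
theorem eq_of_trace_add_trace_le {d : ℕ} {P Q : Matrix (Fin d) (Fin d) ℝ}
    (hP : P.PosDef) (hQ : Q.PosDef) (h : (P⁻¹ * Q).trace + (P * Q⁻¹).trace ≤ 2 * d) : P = Q := by
  have happrox := loewnerApprox_of_trace_add_trace_le hP hQ le_rfl (by linarith)
  simp only [LoewnerApprox, one_div, inv_one, one_smul] at happrox
  exact le_antisymm (le_iff.mpr happrox.1) (le_iff.mpr happrox.2)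

omit [DecidableEq m] in
theorem eq_zero_of_trace_mul_posDef {Z Q : Matrix m m ℝ} (hZ : Z.PosSemidef) (hQ : Q.PosDef)
    (h : (Z * Q).trace = 0) : Z = 0 := by
  classical
  obtain ⟨B, hB, rfl⟩ := exists_isUnit_transpose_mul_self hQ
  have hBZ : (B * Z * Bᵀ).PosSemidef := by
    simpa using hZ.mul_mul_conjTranspose_same B
  have hzero : B * Z * Bᵀ = 0 := by
    rw [← hBZ.trace_eq_zero_iff, Matrix.trace_mul_comm, ← Matrix.mul_assoc,
      Matrix.trace_mul_comm, h]
  have hBt : IsUnit Bᵀ := (isUnit_transpose B).mpr hB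
  rw [hBt.mul_left_eq_zero] at hzero
  rwa [hB.mul_right_eq_zero] at hzero

theorem det_add_smul_vecMulVec {Q : Matrix m m ℝ} (hQ : IsUnit Q.det) (t : ℝ) (y : m → ℝ) :
    (Q + t • vecMulVec y y).det = Q.det * (1 + t * (y ⬝ᵥ Q⁻¹ *ᵥ y)) := by
  have hrank_one : replicateCol Unit (t • y) * replicateRow Unit y = t • vecMulVec y y := by
    rw [← vecMulVec_eq, smul_vecMulVec]
  rw [← hrank_one, det_add_replicateCol_mul_replicateRow hQ]
  congr 1
  rw [det_unique, Matrix.add_apply, one_apply_eq, Matrix.mul_assoc, ← replicateCol_mulVec,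
    replicateRow_mul_replicateCol_apply, mulVec_smul, dotProduct_smul, smul_eq_mul]

omit [DecidableEq m] in
theorem sq_dotProduct_mulVec_le {X : Matrix m m ℝ} (hX : X.PosSemidef) (x y : m → ℝ) :
    (x ⬝ᵥ X *ᵥ y) ^ 2 ≤ (x ⬝ᵥ X *ᵥ x) * (y ⬝ᵥ X *ᵥ y) := by
  classical
  have hsymm : (toBilin' X).IsSymm :=
    isSymm_toBilin'_iff_isSymm.mpr (transpose_eq_of_posSemidef hX)
  simpa [toBilin'_apply'] using LinearMap.BilinForm.apply_sq_le_of_symm (toBilin' X)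
    (by simpa [toBilin'_apply'] using quad_nonneg hX) ⟨fun x y => hsymm.eq x y⟩ x y

end PosDef

/-! ### Weighted Gram matrices -/

section Gram

variable {ι m : Type*} [Fintype ι] [DecidableEq ι] [Fintype m]

/-- The weighted Gram matrix `Aᵀ diag(v) A`; `weightedGram A p w` has weights `wᵢ ^ (1 - 2 / p)`. -/
def scaledGram (A : Matrix ι m ℝ) (v : ι → ℝ) : Matrix m m ℝ :=
  Aᵀ * diagonal v * A

omit [Fintype m] in
theorem scaledGram_apply (A : Matrix ι m ℝ) (v : ι → ℝ) (j k : m) :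
    scaledGram A v j k = ∑ i, v i * A i j * A i k := by
  rw [scaledGram, mul_apply]
  exact Finset.sum_congr rfl fun i _ => by rw [mul_diagonal, transpose_apply, mul_comm (A i j)]

omit [Fintype m] in
theorem scaledGram_transpose (A : Matrix ι m ℝ) (v : ι → ℝ) :
    (scaledGram A v)ᵀ = scaledGram A v := by
  simp [scaledGram, transpose_mul, Matrix.mul_assoc]

omit [Fintype ι] [DecidableEq ι] in
theorem mul_mul_transpose_apply_self (A : Matrix ι m ℝ) (M : Matrix m m ℝ) (i : ι) :
    (A * M * Aᵀ) i i = A i ⬝ᵥ M *ᵥ A i := by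
  rw [mul_apply, dotProduct_mulVec]
  rfl

theorem trace_scaledGram_mul (A : Matrix ι m ℝ) (v : ι → ℝ) (M : Matrix m m ℝ) :
    (scaledGram A v * M).trace = ∑ i, v i * (A i ⬝ᵥ M *ᵥ A i) := by
  rw [scaledGram, Matrix.mul_assoc, Matrix.mul_assoc, Matrix.trace_mul_comm, Matrix.mul_assoc,
    trace]
  exact Finset.sum_congr rfl fun i _ => by
    rw [diag_apply, diagonal_mul, mul_mul_transpose_apply_self]

theorem quad_scaledGram (A : Matrix ι m ℝ) (v : ι → ℝ) (x : m → ℝ) :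
    x ⬝ᵥ scaledGram A v *ᵥ x = ∑ i, v i * (A i ⬝ᵥ x) ^ 2 := by
  rw [scaledGram, ← mulVec_mulVec, ← mulVec_mulVec, dotProduct_mulVec, vecMul_transpose, dotProduct]
  refine Finset.sum_congr rfl fun i _ => ?_
  rw [mulVec_diagonal]
  simp only [mulVec]
  ring

omit [Fintype m] in
theorem scaledGram_posSemidef [Finite m] (A : Matrix ι m ℝ) {v : ι → ℝ} (hv : 0 ≤ v) :
    (scaledGram A v).PosSemidef := by
  simpa [scaledGram] using (PosSemidef.diagonal hv).conjTranspose_mul_mul_same A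

/-- Nonnegative weights that are positive on the nonzero rows of `A`: the weights for which
`Aᵀ diag(v) A` is positive definite as soon as `A` has full column rank. -/
def PosOnRows (A : Matrix ι m ℝ) (v : ι → ℝ) : Prop :=
  0 ≤ v ∧ ∀ i, A i ≠ 0 → 0 < v i

theorem scaledGram_posDef {A : Matrix ι m ℝ} (hA : Function.Injective A.mulVec) {v : ι → ℝ}
    (hv : PosOnRows A v) : (scaledGram A v).PosDef := by
  refine .of_dotProduct_mulVec_pos (scaledGram_posSemidef A hv.1).1 fun x hx => ?_
  rw [star_trivial, quad_scaledGram]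
  obtain ⟨i, hi⟩ := Function.ne_iff.mp fun h : A *ᵥ x = 0 => hx (hA (h.trans (mulVec_zero A).symm))
  have hAx : A i ⬝ᵥ x ≠ 0 := hi
  have hvi : 0 < v i := hv.2 i fun h => hAx (by rw [h, zero_dotProduct])
  exact Finset.sum_pos' (fun i _ => mul_nonneg (hv.1 i) (sq_nonneg _))
    ⟨i, Finset.mem_univ _, by positivity⟩

omit [DecidableEq ι] in
theorem exists_left_inverse [DecidableEq m] {A : Matrix ι m ℝ} (hA : Function.Injective A.mulVec) :
    ∃ L : Matrix m ι ℝ, L * A = 1 := by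
  classical
  have hG : (scaledGram A 1).PosDef := scaledGram_posDef hA ⟨zero_le_one, fun _ _ => one_pos⟩
  refine ⟨(scaledGram A 1)⁻¹ * Aᵀ, ?_⟩
  rw [Matrix.mul_assoc, show Aᵀ * A = scaledGram A 1 by simp [scaledGram],
    nonsing_inv_mul _ (isUnit_det_of_posDef hG)]

end Gram

theorem mulVec_injective_of_rank_eq {n d : ℕ} {A : Matrix (Fin n) (Fin d) ℝ} (hA : A.rank = d) :
    Function.Injective A.mulVec := by
  rw [mulVec_injective_iff, linearIndependent_iff_card_eq_finrank_span, Set.finrank,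
    ← rank_eq_finrank_span_cols, hA, Fintype.card_fin]

/-! ### Feasible matrices -/

theorem rpow_half_rpow {p x : ℝ} (hp : p ≠ 0) (hx : 0 ≤ x) : (x ^ (p / 2)) ^ (2 / p) = x := by
  rw [← inv_div p, Real.rpow_rpow_inv hx (div_ne_zero hp two_ne_zero)]

theorem rpow_two_div_rpow {p x : ℝ} (hp : p ≠ 0) (hx : 0 ≤ x) : (x ^ (2 / p)) ^ (p / 2) = x := by
  rw [← inv_div p, Real.rpow_inv_rpow hx (div_ne_zero hp two_ne_zero)]

theorem one_sub_two_div_nonneg {p : ℝ} (hp : 2 ≤ p) : 0 ≤ 1 - 2 / p := by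
  rw [sub_nonneg, div_le_one (by linarith)]
  exact hp

theorem rpow_mul_le {p : ℝ} (hp : 2 ≤ p) {w τ : ℝ} (hw : 0 ≤ w) (hτ : 0 ≤ τ) :
    w ^ (1 - 2 / p) * τ ≤ (1 - 2 / p) * w + 2 / p * τ ^ (p / 2) := by
  have hyoung := Real.geom_mean_le_arith_mean2_weighted (one_sub_two_div_nonneg hp)
    (by positivity : 0 ≤ 2 / p) hw (Real.rpow_nonneg hτ (p / 2)) (by ring)
  rwa [rpow_half_rpow (by linarith) hτ] at hyoung

theorem abs_apply_le_of_posSemidef {m : Type*} [Finite m] {N : Matrix m m ℝ}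
    (hN : N.PosSemidef) {b : ℝ} (hb : ∀ i, N i i ≤ b) (i j : m) : |N i j| ≤ b := by
  classical
  cases nonempty_fintype m
  have hsymm : N j i = N i j := congrFun (congrFun (transpose_eq_of_posSemidef hN) i) j
  have hquad : ∀ c : ℝ, (Pi.single i 1 + c • Pi.single j 1 : m → ℝ) ⬝ᵥ
      N *ᵥ (Pi.single i 1 + c • Pi.single j 1) = N i i + 2 * c * N i j + c ^ 2 * N j j := by
    intro c
    simp only [mulVec_add, mulVec_single, MulOpposite.op_one, one_smul, mulVec_smul, dotProduct_add,
      add_dotProduct, single_dotProduct, col_apply, one_mul, smul_dotProduct, hsymm, smul_eq_mul,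
      dotProduct_smul]
    ring
  have hplus := hquad 1 ▸ quad_nonneg hN (Pi.single i 1 + (1 : ℝ) • Pi.single j 1)
  have hminus := hquad (-1) ▸ quad_nonneg hN (Pi.single i 1 + (-1 : ℝ) • Pi.single j 1)
  have hi := hb i
  have hj := hb j
  rw [abs_le]
  constructor <;> linarith

section Feasible

variable {n d : ℕ} {A : Matrix (Fin n) (Fin d) ℝ} {p : ℝ}

/-- The sum `∑ᵢ (aᵢᵀ M aᵢ) ^ (p / 2)` that the determinant maximization program bounds by `d`. -/
noncomputable def rpowSum (A : Matrix (Fin n) (Fin d) ℝ) (p : ℝ) (M : Matrix (Fin d) (Fin d) ℝ) :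
    ℝ :=
  ∑ i, (A i ⬝ᵥ M *ᵥ A i) ^ (p / 2)

theorem rpowSum_nonneg {M : Matrix (Fin d) (Fin d) ℝ} (hM : M.PosSemidef) : 0 ≤ rpowSum A p M :=
  Finset.sum_nonneg fun _ _ => Real.rpow_nonneg (quad_nonneg hM _) _

theorem rpowSum_smul {M : Matrix (Fin d) (Fin d) ℝ} (hM : M.PosSemidef) {s : ℝ} (hs : 0 ≤ s) :
    rpowSum A p (s • M) = s ^ (p / 2) * rpowSum A p M := by
  rw [rpowSum, rpowSum, Finset.mul_sum]
  refine Finset.sum_congr rfl fun i _ => ?_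
  rw [smul_mulVec, dotProduct_smul, smul_eq_mul, Real.mul_rpow hs (quad_nonneg hM _)]

theorem isFeasible_smul_of_rpowSum_le (hp : p ≠ 0) {M : Matrix (Fin d) (Fin d) ℝ}
    (hM : M.PosSemidef) {g : ℝ} (hg : 0 < g) (hMg : rpowSum A p M ≤ g) :
    IsFeasible A p ((d / g) ^ (2 / p) • M) := by
  have hdg : 0 ≤ d / g := by positivity
  refine ⟨hM.smul (by positivity), ?_⟩
  calc rpowSum A p ((d / g) ^ (2 / p) • M) = d / g * rpowSum A p M := by
        rw [rpowSum_smul hM (by positivity), rpow_two_div_rpow hp hdg]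
    _ ≤ d / g * g := mul_le_mul_of_nonneg_left hMg hdg
    _ = d := div_mul_cancel₀ _ hg.ne'

theorem exists_isFeasible_smul_one (A : Matrix (Fin n) (Fin d) ℝ) (hd : 0 < d) (hp : p ≠ 0) :
    ∃ s : ℝ, 0 < s ∧ IsFeasible A p (s • 1) :=
  ⟨(d / max (rpowSum A p 1) 1) ^ (2 / p), by positivity,
    isFeasible_smul_of_rpowSum_le hp .one (by positivity) (le_max_left _ _)⟩

theorem IsFeasible.trace_weightedGram_mul_le (hp : 2 ≤ p) {w : Fin n → ℝ} (hw : ∀ i, 0 ≤ w i)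
    (hsum : ∑ i, w i ≤ d) {M : Matrix (Fin d) (Fin d) ℝ} (hM : IsFeasible A p M) :
    (weightedGram A p w * M).trace ≤ d :=
  calc (weightedGram A p w * M).trace = ∑ i, w i ^ (1 - 2 / p) * (A i ⬝ᵥ M *ᵥ A i) :=
        trace_scaledGram_mul A _ M
    _ ≤ ∑ i, ((1 - 2 / p) * w i + 2 / p * (A i ⬝ᵥ M *ᵥ A i) ^ (p / 2)) :=
        Finset.sum_le_sum fun i _ => rpow_mul_le hp (hw i) (quad_nonneg hM.1 _)
    _ = (1 - 2 / p) * ∑ i, w i + 2 / p * ∑ i, (A i ⬝ᵥ M *ᵥ A i) ^ (p / 2) := by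
        rw [Finset.sum_add_distrib, Finset.mul_sum, Finset.mul_sum]
    _ ≤ (1 - 2 / p) * d + 2 / p * d :=
        add_le_add (mul_le_mul_of_nonneg_left hsum (one_sub_two_div_nonneg hp))
          (mul_le_mul_of_nonneg_left hM.2 (by positivity))
    _ = d := by ring

theorem trace_weightedGram_mul_le_of_rpowSum_le (hp : 2 ≤ p) {w : Fin n → ℝ} (hw : ∀ i, 0 ≤ w i)
    (hsum : ∑ i, w i ≤ d) (hd : 0 < d) {M : Matrix (Fin d) (Fin d) ℝ} (hM : M.PosSemidef) {g : ℝ}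
    (hg : 0 < g) (hMg : rpowSum A p M ≤ g) :
    (weightedGram A p w * M).trace ≤ (g / d) ^ (2 / p) * d := by
  have htrace := (isFeasible_smul_of_rpowSum_le (by linarith) hM hg hMg).trace_weightedGram_mul_le
    hp hw hsum
  rwa [Matrix.mul_smul, trace_smul, smul_eq_mul, ← inv_div, Real.inv_rpow (by positivity),
    inv_mul_le_iff₀ (by positivity)] at htrace

theorem IsFeasible.quad_le (hp : 0 < p) {M : Matrix (Fin d) (Fin d) ℝ} (hM : IsFeasible A p M)
    (i : Fin n) : A i ⬝ᵥ M *ᵥ A i ≤ (d : ℝ) ^ (2 / p) := by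
  have hquad := quad_nonneg hM.1 (A i)
  have hterm : (A i ⬝ᵥ M *ᵥ A i) ^ (p / 2) ≤ d :=
    (Finset.single_le_sum (f := fun i => (A i ⬝ᵥ M *ᵥ A i) ^ (p / 2))
      (fun i _ => Real.rpow_nonneg (quad_nonneg hM.1 _) _) (Finset.mem_univ i)).trans hM.2
  rw [← rpow_half_rpow hp.ne' hquad]
  exact Real.rpow_le_rpow (by positivity) hterm (by positivity)

theorem isClosed_isFeasible (hp : 0 ≤ p) : IsClosed {M | IsFeasible A p M} := by
  have hquad : ∀ x : Fin d → ℝ, Continuous fun M : Matrix (Fin d) (Fin d) ℝ => x ⬝ᵥ M *ᵥ x :=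
    fun x => by fun_prop
  have hsum : Continuous (rpowSum A p) := continuous_finsetSum _ fun i _ =>
    (hquad (A i)).rpow_const fun _ => Or.inr (by positivity)
  have hset : {M | IsFeasible A p M} =
      {M | Mᵀ = M} ∩ (⋂ x, {M | 0 ≤ x ⬝ᵥ M *ᵥ x}) ∩ {M | rpowSum A p M ≤ d} := by
    ext M
    simp only [Set.mem_inter_iff, Set.mem_iInter, Set.mem_ofPred_eq]
    exact ⟨fun h => ⟨⟨transpose_eq_of_posSemidef h.1, quad_nonneg h.1⟩, h.2⟩,
      fun h => ⟨posSemidef_of_quad_nonneg h.1.1 h.1.2, h.2⟩⟩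
  rw [hset]
  exact ((isClosed_eq (by fun_prop) continuous_id).inter
    (isClosed_iInter fun x => isClosed_le continuous_const (hquad x))).inter
    (isClosed_le hsum continuous_const)

theorem isCompact_isFeasible (hA : Function.Injective A.mulVec) (hp : 0 < p) :
    IsCompact {M | IsFeasible A p M} := by
  obtain ⟨L, hL⟩ := exists_left_inverse hA
  set b : ℝ := (d : ℝ) ^ (2 / p)
  have hbox : IsCompact (Set.univ.pi fun _ => Set.univ.pi fun _ => Set.Icc (-b) b :
      Set (Matrix (Fin n) (Fin n) ℝ)) :=
    isCompact_univ_pi fun _ => isCompact_univ_pi fun _ => isCompact_Icc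
  have hcont : Continuous fun N : Matrix (Fin n) (Fin n) ℝ => L * N * Lᵀ := by fun_prop
  refine (hbox.image hcont).of_isClosed_subset (isClosed_isFeasible hp.le) fun M hM =>
    ⟨A * M * Aᵀ, fun i _ j _ => ?_, ?_⟩
  · have hpsd : (A * M * Aᵀ).PosSemidef := by simpa using hM.1.mul_mul_conjTranspose_same A
    refine abs_le.mp (abs_apply_le_of_posSemidef hpsd (fun i => ?_) i j)
    rw [mul_mul_transpose_apply_self]
    exact hM.quad_le hp i
  · calc L * (A * M * Aᵀ) * Lᵀ = L * A * M * (L * A)ᵀ := by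
          simp only [transpose_mul, Matrix.mul_assoc]
      _ = M := by rw [hL, transpose_one, Matrix.one_mul, Matrix.mul_one]

theorem exists_isLewisForm (hA : Function.Injective A.mulVec) (hd : 0 < d) (hp : 0 < p) :
    ∃ Q, IsLewisForm A p Q := by
  obtain ⟨s, -, hs⟩ := exists_isFeasible_smul_one A hd hp.ne'
  obtain ⟨Q, hQ, hmax⟩ := (isCompact_isFeasible hA hp).exists_isMaxOn ⟨_, hs⟩
    (f := fun M : Matrix (Fin d) (Fin d) ℝ => M.det) (by fun_prop)
  exact ⟨Q, hQ, fun M hM => hmax hM⟩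

theorem IsLewisForm.posDef (hd : 0 < d) (hp : p ≠ 0) {Q : Matrix (Fin d) (Fin d) ℝ}
    (hQ : IsLewisForm A p Q) : Q.PosDef := by
  obtain ⟨s, hs, hfeas⟩ := exists_isFeasible_smul_one A hd hp
  have hdet : 0 < (s • (1 : Matrix (Fin d) (Fin d) ℝ)).det := by
    rw [det_smul, det_one, mul_one]
    positivity
  exact hQ.1.1.posDef_iff_det_ne_zero.mpr (hdet.trans_le (hQ.2 _ hfeas)).ne'

end Feasible

/-! ### First-order optimality -/

section Optimality

theorem deriv_nonneg_of_nonneg_right {h : ℝ → ℝ} {h' : ℝ} (hderiv : HasDerivAt h h' 0)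
    (h_zero : h 0 = 0) (h_nonneg : ∀ t, 0 ≤ t → 0 ≤ h t) : 0 ≤ h' := by
  have hslope := (hasDerivWithinAt_iff_tendsto_slope' (s := Set.Ioi (0 : ℝ)) (by simp)).mp
    hderiv.hasDerivWithinAt
  refine ge_of_tendsto hslope ?_
  filter_upwards [self_mem_nhdsWithin] with t ht
  rw [slope_def_field, h_zero, sub_zero, sub_zero]
  exact div_nonneg (h_nonneg t (le_of_lt ht)) (le_of_lt ht)

theorem hasDerivAt_add_mul_rpow {a q : ℝ} (c : ℝ) (hq : a ≠ 0 ∨ 1 ≤ q) :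
    HasDerivAt (fun t : ℝ => (a + t * c) ^ q) (c * q * a ^ (q - 1)) 0 := by
  have hlin : HasDerivAt (fun t : ℝ => a + t * c) c 0 := by
    simpa using ((hasDerivAt_id (0 : ℝ)).mul_const c).const_add a
  simpa using hlin.rpow_const (p := q) (by simpa using hq)

theorem quad_add_smul_vecMulVec {m : Type*} [Fintype m] (Q : Matrix m m ℝ) (t : ℝ) (a y : m → ℝ) :
    a ⬝ᵥ (Q + t • vecMulVec y y) *ᵥ a = a ⬝ᵥ Q *ᵥ a + t * (a ⬝ᵥ y) ^ 2 := by
  rw [add_mulVec, dotProduct_add, smul_mulVec, dotProduct_smul, vecMulVec_mulVec,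
    op_smul_eq_smul, dotProduct_smul, smul_eq_mul, smul_eq_mul, dotProduct_comm y a]
  ring

variable {n d : ℕ} {A : Matrix (Fin n) (Fin d) ℝ} {p : ℝ} {Q : Matrix (Fin d) (Fin d) ℝ}

theorem IsLewisForm.mul_det_div_rpow_le_rpowSum (hQ : IsLewisForm A p Q) (hd : 0 < d) (hp : 0 < p)
    {M : Matrix (Fin d) (Fin d) ℝ} (hM : M.PosSemidef) :
    d * (M.det / Q.det) ^ (p / (2 * d)) ≤ rpowSum A p M := by
  have hQdet := (hQ.posDef hd hp.ne').det_pos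
  refine le_of_forall_gt_imp_ge_of_dense fun g hg => ?_
  have hg0 : 0 < g := (rpowSum_nonneg hM).trans_lt hg
  have hmax : (d / g) ^ (2 / p * d) * M.det ≤ Q.det := by
    have := hQ.2 _ (isFeasible_smul_of_rpowSum_le hp.ne' hM hg0 hg.le)
    rwa [det_smul, Fintype.card_fin, ← Real.rpow_natCast, ← Real.rpow_mul (by positivity)] at this
  have hratio : M.det / Q.det ≤ (g / d) ^ (2 / p * d) := by
    rw [← inv_div (d : ℝ) g, Real.inv_rpow (by positivity), div_le_iff₀ hQdet, inv_mul_eq_div,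
      le_div_iff₀ (by positivity), mul_comm]
    exact hmax
  calc d * (M.det / Q.det) ^ (p / (2 * d))
      ≤ d * ((g / d) ^ (2 / p * d)) ^ (p / (2 * d)) := by
        gcongr
        exact div_nonneg hM.det_nonneg hQdet.le
    _ = g := by
        rw [← Real.rpow_mul (by positivity), show 2 / p * d * (p / (2 * d)) = 1 by field_simp,
          Real.rpow_one, mul_div_cancel₀ _ (Nat.cast_ne_zero.mpr hd.ne')]

theorem IsLewisForm.rpowSum_eq (hQ : IsLewisForm A p Q) (hd : 0 < d) (hp : 0 < p) :
    rpowSum A p Q = d := by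
  refine le_antisymm hQ.1.2 ?_
  simpa [div_self (hQ.posDef hd hp.ne').det_pos.ne'] using
    hQ.mul_det_div_rpow_le_rpowSum hd hp hQ.1.1

theorem IsLewisForm.mul_one_add_rpow_le (hQ : IsLewisForm A p Q) (hd : 0 < d) (hp : 0 < p)
    (y : Fin d → ℝ) {t : ℝ} (ht : 0 ≤ t) :
    d * (1 + t * (y ⬝ᵥ Q⁻¹ *ᵥ y)) ^ (p / (2 * d)) ≤
      ∑ i, (A i ⬝ᵥ Q *ᵥ A i + t * (A i ⬝ᵥ y) ^ 2) ^ (p / 2) := by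
  have hQpd := hQ.posDef hd hp.ne'
  have hM : (Q + t • vecMulVec y y).PosSemidef :=
    hQpd.posSemidef.add (PosSemidef.smul (by simpa using posSemidef_vecMulVec_self_star y) ht)
  have h := hQ.mul_det_div_rpow_le_rpowSum hd hp hM
  rw [det_add_smul_vecMulVec (isUnit_det_of_posDef hQpd),
    mul_div_cancel_left₀ _ hQpd.det_pos.ne'] at h
  simpa only [rpowSum, quad_add_smul_vecMulVec] using h

theorem IsLewisForm.quad_inv_le (hQ : IsLewisForm A p Q) (hd : 0 < d) (hp : 2 ≤ p)
    (y : Fin d → ℝ) :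
    y ⬝ᵥ Q⁻¹ *ᵥ y ≤ ∑ i, (A i ⬝ᵥ Q *ᵥ A i) ^ (p / 2 - 1) * (A i ⬝ᵥ y) ^ 2 := by
  have hp0 : 0 < p := by linarith
  set τ := fun i => A i ⬝ᵥ Q *ᵥ A i
  set u := y ⬝ᵥ Q⁻¹ *ᵥ y
  have hderiv : HasDerivAt (fun t : ℝ => ∑ i, (τ i + t * (A i ⬝ᵥ y) ^ 2) ^ (p / 2) -
      d * (1 + t * u) ^ (p / (2 * d)))
      (∑ i, (A i ⬝ᵥ y) ^ 2 * (p / 2) * τ i ^ (p / 2 - 1) -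
        d * (u * (p / (2 * d)) * 1 ^ (p / (2 * d) - 1))) 0 :=
    .sub (.fun_sum fun i _ => hasDerivAt_add_mul_rpow _ (.inr (by linarith)))
      ((hasDerivAt_add_mul_rpow _ (.inl one_ne_zero)).const_mul _)
  have hnonneg := deriv_nonneg_of_nonneg_right hderiv
    (by
      simp only [zero_mul, add_zero, Real.one_rpow, mul_one]
      exact sub_eq_zero.mpr (hQ.rpowSum_eq hd hp0))
    fun t ht => sub_nonneg.mpr (hQ.mul_one_add_rpow_le hd hp0 y ht)
  have hfactor : ∑ i, (A i ⬝ᵥ y) ^ 2 * (p / 2) * τ i ^ (p / 2 - 1) -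
      d * (u * (p / (2 * d)) * 1 ^ (p / (2 * d) - 1)) =
      (∑ i, τ i ^ (p / 2 - 1) * (A i ⬝ᵥ y) ^ 2 - u) * (p / 2) := by
    rw [Real.one_rpow, sub_mul, Finset.sum_mul]
    congr 1
    · exact Finset.sum_congr rfl fun i _ => by ring
    · field_simp
  rw [hfactor] at hnonneg
  exact sub_nonneg.mp (nonneg_of_mul_nonneg_left hnonneg (by positivity))

theorem IsLewisForm.inv_eq_scaledGram (hQ : IsLewisForm A p Q) (hd : 0 < d) (hp : 2 ≤ p) :
    Q⁻¹ = scaledGram A fun i => (A i ⬝ᵥ Q *ᵥ A i) ^ (p / 2 - 1) := by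
  have hp0 : 0 < p := by linarith
  have hQpd := hQ.posDef hd hp0.ne'
  set G := scaledGram A fun i => (A i ⬝ᵥ Q *ᵥ A i) ^ (p / 2 - 1)
  have hpsd : (G - Q⁻¹).PosSemidef := by
    refine posSemidef_of_quad_nonneg ?_ fun y => ?_
    · rw [transpose_sub, scaledGram_transpose, transpose_eq_of_posSemidef hQpd.inv.posSemidef]
    · rw [sub_mulVec, dotProduct_sub, quad_scaledGram]
      exact sub_nonneg.mpr (hQ.quad_inv_le hd hp y)
  have htrace : (G * Q).trace = d := by
    rw [trace_scaledGram_mul, ← hQ.rpowSum_eq hd hp0]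
    refine Finset.sum_congr rfl fun i _ => ?_
    rw [← Real.rpow_add_one' (quad_nonneg hQ.1.1 _) (by linarith), sub_add_cancel]
  refine (sub_eq_zero.mp (eq_zero_of_trace_mul_posDef hpsd hQpd ?_)).symm
  rw [Matrix.sub_mul, trace_sub, htrace, nonsing_inv_mul _ (isUnit_det_of_posDef hQpd), trace_one,
    Fintype.card_fin, sub_self]

theorem IsLewisForm.inv_eq_weightedGram (hQ : IsLewisForm A p Q) (hd : 0 < d) (hp : 2 ≤ p) :
    Q⁻¹ = weightedGram A p fun i => (A i ⬝ᵥ Q *ᵥ A i) ^ (p / 2) := by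
  rw [hQ.inv_eq_scaledGram hd hp, weightedGram, scaledGram]
  congr 3
  funext i
  rw [← Real.rpow_mul (quad_nonneg hQ.1.1 _)]
  congr 1
  field_simp

theorem IsLewisForm.isLewisWeights (hQ : IsLewisForm A p Q) (hd : 0 < d) (hp : 2 ≤ p) :
    IsLewisWeights A p fun i => (A i ⬝ᵥ Q *ᵥ A i) ^ (p / 2) := by
  have hQpd := hQ.posDef hd (by linarith)
  have hquad := fun i => quad_nonneg hQ.1.1 (A i)
  refine ⟨fun i => Real.rpow_nonneg (hquad i) _, ?_, fun i => ?_⟩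
  · rw [← hQ.inv_eq_weightedGram hd hp]
    exact isUnit_det_of_posDef hQpd.inv
  · rw [← hQ.inv_eq_weightedGram hd hp, nonsing_inv_nonsing_inv _ (isUnit_det_of_posDef hQpd),
      rpow_half_rpow (by linarith) (hquad i)]

end Optimality

/-! ### Leverage scores and uniqueness -/

section Uniqueness

variable {n d : ℕ} {A : Matrix (Fin n) (Fin d) ℝ} {p : ℝ} {w : Fin n → ℝ}

/-- The leverage score of the `i`-th row of `W ^ (1 / 2 - 1 / p) A`. The Lewis weights are the
weights that equal their leverage scores. -/
noncomputable def leverage (A : Matrix (Fin n) (Fin d) ℝ) (p : ℝ) (w : Fin n → ℝ) (i : Fin n) : ℝ :=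
  w i ^ (1 - 2 / p) * (A i ⬝ᵥ (weightedGram A p w)⁻¹ *ᵥ A i)

theorem weightedGram_posSemidef (A : Matrix (Fin n) (Fin d) ℝ) (p : ℝ) (hw : 0 ≤ w) :
    (weightedGram A p w).PosSemidef :=
  scaledGram_posSemidef A fun i => Real.rpow_nonneg (hw i) _

theorem sum_leverage (hw : IsUnit (weightedGram A p w).det) : ∑ i, leverage A p w i = d := by
  have htrace : (weightedGram A p w * (weightedGram A p w)⁻¹).trace = ∑ i, leverage A p w i :=
    trace_scaledGram_mul A _ _
  rw [← htrace, mul_nonsing_inv _ hw, trace_one, Fintype.card_fin]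

theorem IsLewisWeights.leverage_eq (hw : IsLewisWeights A p w) (i : Fin n) :
    leverage A p w i = w i := by
  rw [leverage, hw.2.2 i, ← Real.rpow_add' (hw.1 i) (by simp), sub_add_cancel, Real.rpow_one]

theorem IsLewisWeights.sum_eq (hw : IsLewisWeights A p w) : ∑ i, w i = d := by
  rw [← sum_leverage hw.2.1]
  exact Finset.sum_congr rfl fun i _ => (hw.leverage_eq i).symm

theorem IsLewisWeights.posDef (hw : IsLewisWeights A p w) : (weightedGram A p w).PosDef :=
  (weightedGram_posSemidef A p hw.1).posDef_iff_det_ne_zero.mpr hw.2.1.ne_zero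

theorem IsLewisWeights.eq_rpow (hw : IsLewisWeights A p w) (hp : p ≠ 0) (i : Fin n) :
    w i = (A i ⬝ᵥ (weightedGram A p w)⁻¹ *ᵥ A i) ^ (p / 2) := by
  rw [hw.2.2 i, rpow_two_div_rpow hp (hw.1 i)]

theorem IsLewisWeights.isFeasible_inv (hw : IsLewisWeights A p w) (hp : p ≠ 0) :
    IsFeasible A p (weightedGram A p w)⁻¹ :=
  ⟨hw.posDef.inv.posSemidef, by simp only [← hw.eq_rpow hp, hw.sum_eq, le_refl]⟩

theorem IsLewisWeights.eq (hw : IsLewisWeights A p w) {w' : Fin n → ℝ}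
    (hw' : IsLewisWeights A p w') (hp : 2 ≤ p) : w = w' := by
  have hp0 : p ≠ 0 := by linarith
  have hgram : weightedGram A p w = weightedGram A p w' := by
    refine eq_of_trace_add_trace_le hw.posDef hw'.posDef ?_
    rw [Matrix.trace_mul_comm, two_mul]
    exact add_le_add
      ((hw.isFeasible_inv hp0).trace_weightedGram_mul_le hp hw'.1 hw'.sum_eq.le)
      ((hw'.isFeasible_inv hp0).trace_weightedGram_mul_le hp hw.1 hw.sum_eq.le)
  funext i
  rw [hw.eq_rpow hp0, hw'.eq_rpow hp0, hgram]

theorem IsLewisForm.eq_inv (hw : IsLewisWeights A p w) {Q : Matrix (Fin d) (Fin d) ℝ}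
    (hQ : IsLewisForm A p Q) (hd : 0 < d) (hp : 2 ≤ p) : Q = (weightedGram A p w)⁻¹ := by
  have hQunit := isUnit_det_of_posDef (hQ.posDef hd (by linarith))
  rw [hw.eq (hQ.isLewisWeights hd hp) hp, ← hQ.inv_eq_weightedGram hd hp,
    nonsing_inv_nonsing_inv _ hQunit]

theorem exists_isLewisWeights_isLewisForm (hA : Function.Injective A.mulVec) (hd : 0 < d)
    (hp : 2 ≤ p) : ∃ w, IsLewisWeights A p w ∧ IsLewisForm A p (weightedGram A p w)⁻¹ := by
  obtain ⟨Q, hQ⟩ := exists_isLewisForm hA hd (by linarith : 0 < p)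
  have hw := hQ.isLewisWeights hd hp
  exact ⟨_, hw, hQ.eq_inv hw hd hp ▸ hQ⟩

end Uniqueness

/-! ### Log-convexity of inverse quadratic forms -/

section LogConvexity

variable {m : Type*}

theorem convex_setOf_posDef : Convex ℝ {X : Matrix m m ℝ | X.PosDef} :=
  convex_iff_forall_pos.mpr fun _ hX _ hY _ _ hs ht _ => (PosDef.smul hX hs).add (PosDef.smul hY ht)

variable [Fintype m] [DecidableEq m]

theorem two_mul_log_dotProduct_le {X : Matrix m m ℝ} (hX : X.PosDef) {a y : m → ℝ} (ha : a ≠ 0)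
    (hy : y ≠ 0) (hay : 0 < a ⬝ᵥ y) :
    2 * Real.log (a ⬝ᵥ y) ≤ Real.log (a ⬝ᵥ X⁻¹ *ᵥ a) + Real.log (y ⬝ᵥ X *ᵥ y) := by
  set x := X⁻¹ *ᵥ a
  have hXx : X *ᵥ x = a := by
    rw [mulVec_mulVec, mul_nonsing_inv _ (isUnit_det_of_posDef hX), one_mulVec]
  have hxy : x ⬝ᵥ X *ᵥ y = a ⬝ᵥ y := by
    rw [dotProduct_mulVec, ← mulVec_transpose, transpose_eq_of_posSemidef hX.posSemidef, hXx]
  have hcs := sq_dotProduct_mulVec_le hX.posSemidef x y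
  rw [hxy, hXx, dotProduct_comm x] at hcs
  have hlog := Real.log_le_log (pow_pos hay 2) hcs
  rwa [Real.log_pow, Nat.cast_ofNat,
    Real.log_mul (quad_pos hX.inv ha).ne' (quad_pos hX hy).ne'] at hlog

theorem convexOn_log_quad_inv {a : m → ℝ} (ha : a ≠ 0) :
    ConvexOn ℝ {X : Matrix m m ℝ | X.PosDef} fun X => Real.log (a ⬝ᵥ X⁻¹ *ᵥ a) := by
  refine ⟨convex_setOf_posDef, fun X hX Y hY s t hs ht hst => ?_⟩
  have hZ : (s • X + t • Y).PosDef := convex_setOf_posDef hX hY hs ht hst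
  set Z := s • X + t • Y with hZ_def
  set y := Z⁻¹ *ᵥ a
  have hZy : Z *ᵥ y = a := by
    rw [mulVec_mulVec, mul_nonsing_inv _ (isUnit_det_of_posDef hZ), one_mulVec]
  have hy : y ≠ 0 := fun h => ha (by rw [← hZy, h, mulVec_zero])
  have hay : 0 < a ⬝ᵥ y := quad_pos hZ.inv ha
  have hsplit : s * (y ⬝ᵥ X *ᵥ y) + t * (y ⬝ᵥ Y *ᵥ y) = a ⬝ᵥ y := by
    have : a ⬝ᵥ y = y ⬝ᵥ Z *ᵥ y := by rw [hZy, dotProduct_comm]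
    rw [this, hZ_def]
    simp only [add_mulVec, smul_mulVec, dotProduct_add, dotProduct_smul, smul_eq_mul]
  have hlog : s * Real.log (y ⬝ᵥ X *ᵥ y) + t * Real.log (y ⬝ᵥ Y *ᵥ y) ≤ Real.log (a ⬝ᵥ y) := by
    rw [← hsplit]
    exact strictConcaveOn_log_Ioi.concaveOn.2 (quad_pos hX hy) (quad_pos hY hy) hs ht hst
  have hX_le := mul_le_mul_of_nonneg_left (two_mul_log_dotProduct_le hX ha hy hay) hs
  have hY_le := mul_le_mul_of_nonneg_left (two_mul_log_dotProduct_le hY ha hy hay) ht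
  have hdouble : 2 * Real.log (a ⬝ᵥ y) =
      s * (2 * Real.log (a ⬝ᵥ y)) + t * (2 * Real.log (a ⬝ᵥ y)) := by
    rw [← add_mul, hst, one_mul]
  simp only [smul_eq_mul]
  change Real.log (a ⬝ᵥ y) ≤ _
  linarith

end LogConvexity

/-! ### The averaged fixed-point iteration -/

section Iteration

variable {n d : ℕ} {A : Matrix (Fin n) (Fin d) ℝ} {p : ℝ}

/-- The fixed-point iteration `w ↦ leverage A p w` for the Lewis weights, started at the uniform
weights `d / n`. -/
noncomputable def lewisIter (A : Matrix (Fin n) (Fin d) ℝ) (p : ℝ) : ℕ → Fin n → ℝ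
  | 0 => fun _ => d / n
  | k + 1 => leverage A p (lewisIter A p k)

/-- The average of `w ^ (1 - 2 / p)` over the first `T` iterates `w` of `lewisIter`. -/
noncomputable def averageWeight (A : Matrix (Fin n) (Fin d) ℝ) (p : ℝ) (T : ℕ) : Fin n → ℝ :=
  fun i => ∑ k ∈ Finset.range T, (T : ℝ)⁻¹ * lewisIter A p k i ^ (1 - 2 / p)

theorem PosOnRows.weightedGram_posDef {w : Fin n → ℝ} (hw : PosOnRows A w)
    (hA : Function.Injective A.mulVec) : (weightedGram A p w).PosDef :=
  scaledGram_posDef hA ⟨fun i => Real.rpow_nonneg (hw.1 i) _,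
    fun i hi => Real.rpow_pos_of_pos (hw.2 i hi) _⟩

theorem pos_of_mulVec_injective (hA : Function.Injective A.mulVec) (hd : 0 < d) : 0 < n := by
  by_contra! hn
  obtain rfl := Nat.le_zero.mp hn
  have h : (1 : Fin d → ℝ) = 0 := hA (Subsingleton.elim _ _)
  simpa using congrFun h ⟨0, hd⟩

theorem lewisIter_posOnRows (hA : Function.Injective A.mulVec) (hd : 0 < d) (k : ℕ) :
    PosOnRows A (lewisIter A p k) := by
  induction k with
  | zero =>
    have hn := pos_of_mulVec_injective hA hd
    have hpos : (0 : ℝ) < d / n := by positivity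
    exact ⟨fun _ => hpos.le, fun _ _ => hpos⟩
  | succ k ih =>
    have hinv := (ih.weightedGram_posDef (p := p) hA).inv
    exact ⟨fun i => mul_nonneg (Real.rpow_nonneg (ih.1 i) _) (quad_nonneg hinv.posSemidef _),
      fun i hi => mul_pos (Real.rpow_pos_of_pos (ih.2 i hi) _) (quad_pos hinv hi)⟩

theorem weightedGram_lewisIter_posDef (hA : Function.Injective A.mulVec) (hd : 0 < d) (k : ℕ) :
    (weightedGram A p (lewisIter A p k)).PosDef :=
  (lewisIter_posOnRows hA hd k).weightedGram_posDef hA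

theorem sum_lewisIter (hA : Function.Injective A.mulVec) (hd : 0 < d) (k : ℕ) :
    ∑ i, lewisIter A p k i = d := by
  cases k with
  | zero =>
    have hn : (n : ℝ) ≠ 0 := Nat.cast_ne_zero.mpr (pos_of_mulVec_injective hA hd).ne'
    simp only [lewisIter, Finset.sum_const, Finset.card_univ, Fintype.card_fin, nsmul_eq_mul]
    exact mul_div_cancel₀ _ hn
  | succ k => exact sum_leverage (isUnit_det_of_posDef (weightedGram_lewisIter_posDef hA hd k))

theorem lewisIter_le (hA : Function.Injective A.mulVec) (hd : 0 < d) (k : ℕ) (i : Fin n) :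
    lewisIter A p k i ≤ d := by
  rw [← sum_lewisIter (p := p) hA hd k]
  exact Finset.single_le_sum (fun j _ => (lewisIter_posOnRows hA hd k).1 j) (Finset.mem_univ i)

theorem scaledGram_averageWeight (A : Matrix (Fin n) (Fin d) ℝ) (p : ℝ) (T : ℕ) :
    scaledGram A (averageWeight A p T) =
      ∑ k ∈ Finset.range T, (T : ℝ)⁻¹ • weightedGram A p (lewisIter A p k) := by
  ext j l
  change _ = (∑ k ∈ Finset.range T,
    (T : ℝ)⁻¹ • scaledGram A fun i => lewisIter A p k i ^ (1 - 2 / p)) j l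
  simp only [scaledGram_apply, Matrix.sum_apply, Matrix.smul_apply, averageWeight, Finset.sum_mul,
    smul_eq_mul, Finset.mul_sum]
  rw [Finset.sum_comm]
  exact Finset.sum_congr rfl fun k _ => Finset.sum_congr rfl fun i _ => by ring

theorem averageWeight_posOnRows (hA : Function.Injective A.mulVec) (hd : 0 < d) {T : ℕ}
    (hT : 0 < T) : PosOnRows A (averageWeight A p T) := by
  have hw := fun k => lewisIter_posOnRows (p := p) hA hd k
  exact ⟨fun i => Finset.sum_nonneg fun k _ =>
      mul_nonneg (by positivity) (Real.rpow_nonneg ((hw k).1 i) _),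
    fun i hi => Finset.sum_pos
      (fun k _ => mul_pos (by positivity) (Real.rpow_pos_of_pos ((hw k).2 i hi) _))
      ⟨0, Finset.mem_range.mpr hT⟩⟩

theorem scaledGram_averageWeight_posDef (hA : Function.Injective A.mulVec) (hd : 0 < d) {T : ℕ}
    (hT : 0 < T) : (scaledGram A (averageWeight A p T)).PosDef :=
  scaledGram_posDef hA (averageWeight_posOnRows hA hd hT)

theorem sum_range_inv {T : ℕ} (hT : 0 < T) : ∑ _k ∈ Finset.range T, (T : ℝ)⁻¹ = 1 := by
  simp [hT.ne']

theorem log_quad_inv_lewisIter (hA : Function.Injective A.mulVec) (hd : 0 < d) {i : Fin n}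
    (hi : A i ≠ 0) (k : ℕ) :
    Real.log (A i ⬝ᵥ (weightedGram A p (lewisIter A p k))⁻¹ *ᵥ A i) =
      (Real.log (lewisIter A p (k + 1) i) - Real.log (lewisIter A p k i)) +
        2 / p * Real.log (lewisIter A p k i) := by
  have hw := (lewisIter_posOnRows (p := p) hA hd k).2 i hi
  have hquad := quad_pos (weightedGram_lewisIter_posDef (p := p) hA hd k).inv hi
  rw [lewisIter, leverage, Real.log_mul (Real.rpow_pos_of_pos hw _).ne' hquad.ne',
    Real.log_rpow hw]
  ring

theorem log_lewisIter_sub_log_lewisIter_zero_le (hA : Function.Injective A.mulVec) (hd : 0 < d)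
    {i : Fin n} (hi : A i ≠ 0) (k : ℕ) :
    Real.log (lewisIter A p k i) - Real.log (lewisIter A p 0 i) ≤ Real.log n := by
  have hn : (n : ℝ) ≠ 0 := Nat.cast_ne_zero.mpr (pos_of_mulVec_injective hA hd).ne'
  have hd' : (d : ℝ) ≠ 0 := Nat.cast_ne_zero.mpr hd.ne'
  have hk : Real.log (lewisIter A p k i) ≤ Real.log d :=
    Real.log_le_log ((lewisIter_posOnRows hA hd k).2 i hi) (lewisIter_le hA hd k i)
  rw [lewisIter, Real.log_div hd' hn]
  linarith

theorem log_quad_inv_averageWeight_le (hA : Function.Injective A.mulVec) (hd : 0 < d) {T : ℕ}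
    (hT : 0 < T) {i : Fin n} (hi : A i ≠ 0) :
    Real.log (A i ⬝ᵥ (scaledGram A (averageWeight A p T))⁻¹ *ᵥ A i) ≤ Real.log n / T +
      2 / p * ∑ k ∈ Finset.range T, (T : ℝ)⁻¹ * Real.log (lewisIter A p k i) := by
  have hconvex := (convexOn_log_quad_inv hi).map_sum_le (t := Finset.range T)
    (w := fun _ => (T : ℝ)⁻¹) (fun _ _ => by positivity) (sum_range_inv hT)
    fun k _ => weightedGram_lewisIter_posDef (p := p) hA hd k
  rw [← scaledGram_averageWeight] at hconvex
  refine hconvex.trans ?_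
  simp only [log_quad_inv_lewisIter hA hd hi, smul_eq_mul, mul_add, Finset.sum_add_distrib]
  refine add_le_add ?_ (le_of_eq ?_)
  · rw [← Finset.mul_sum, Finset.sum_range_sub fun k => Real.log (lewisIter A p k i),
      div_eq_inv_mul]
    gcongr
    exact log_lewisIter_sub_log_lewisIter_zero_le hA hd hi T
  · rw [Finset.mul_sum]
    exact Finset.sum_congr rfl fun k _ => mul_left_comm _ _ _

theorem mul_sum_log_lewisIter_le (hA : Function.Injective A.mulVec) (hd : 0 < d) {T : ℕ}
    (hT : 0 < T) {i : Fin n} (hi : A i ≠ 0) :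
    (1 - 2 / p) * ∑ k ∈ Finset.range T, (T : ℝ)⁻¹ * Real.log (lewisIter A p k i) ≤
      Real.log (averageWeight A p T i) := by
  have hpos := fun k => (lewisIter_posOnRows (p := p) hA hd k).2 i hi
  have hjensen := strictConcaveOn_log_Ioi.concaveOn.le_map_sum (t := Finset.range T)
    (w := fun _ => (T : ℝ)⁻¹) (p := fun k => lewisIter A p k i ^ (1 - 2 / p))
    (fun _ _ => by positivity) (sum_range_inv hT) fun k _ => Real.rpow_pos_of_pos (hpos k) _
  refine le_of_eq_of_le ?_ hjensen
  rw [Finset.mul_sum]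
  exact Finset.sum_congr rfl fun k _ => by
    rw [Real.log_rpow (hpos k), smul_eq_mul, mul_left_comm]

theorem rpow_quad_inv_averageWeight_le (hA : Function.Injective A.mulVec) (hd : 0 < d)
    (hp : 2 ≤ p) {T : ℕ} (hT : 0 < T) (i : Fin n) :
    (A i ⬝ᵥ (scaledGram A (averageWeight A p T))⁻¹ *ᵥ A i) ^ (p / 2) ≤
      Real.exp ((p / 2 - 1) * (Real.log n / T)) *
        (averageWeight A p T i * (A i ⬝ᵥ (scaledGram A (averageWeight A p T))⁻¹ *ᵥ A i)) := by
  by_cases hi : A i = 0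
  · rw [hi, zero_dotProduct, Real.zero_rpow (by linarith), mul_zero, mul_zero]
  have hτ := quad_pos (scaledGram_averageWeight_posDef (p := p) hA hd hT).inv hi
  have hlogτ := mul_le_mul_of_nonneg_left (log_quad_inv_averageWeight_le (p := p) hA hd hT hi)
    (show 0 ≤ p / 2 - 1 by linarith)
  have hlogv := mul_sum_log_lewisIter_le (p := p) hA hd hT hi
  have hv := (averageWeight_posOnRows (p := p) hA hd hT).2 i hi
  set τ := A i ⬝ᵥ (scaledGram A (averageWeight A p T))⁻¹ *ᵥ A i
  set ℓ := ∑ k ∈ Finset.range T, (T : ℝ)⁻¹ * Real.log (lewisIter A p k i)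
  have hexp : (p / 2 - 1) * (Real.log n / T + 2 / p * ℓ) =
      (p / 2 - 1) * (Real.log n / T) + (1 - 2 / p) * ℓ := by
    have : p ≠ 0 := by linarith
    field_simp
  calc τ ^ (p / 2) = Real.exp ((p / 2 - 1) * Real.log τ) * τ := by
        rw [mul_comm (p / 2 - 1), ← Real.rpow_def_of_pos hτ, ← Real.rpow_add_one hτ.ne',
          sub_add_cancel]
    _ ≤ Real.exp ((p / 2 - 1) * (Real.log n / T) + Real.log (averageWeight A p T i)) * τ := by
        gcongr
        linarith
    _ = _ := by rw [Real.exp_add, Real.exp_log hv, mul_assoc]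

theorem rpowSum_inv_averageWeight_le (hA : Function.Injective A.mulVec) (hd : 0 < d) (hp : 2 ≤ p)
    {T : ℕ} (hT : 0 < T) : rpowSum A p (scaledGram A (averageWeight A p T))⁻¹ ≤
      Real.exp ((p / 2 - 1) * (Real.log n / T)) * d := by
  have hunit := isUnit_det_of_posDef (scaledGram_averageWeight_posDef (p := p) hA hd hT)
  refine (Finset.sum_le_sum fun i _ => rpow_quad_inv_averageWeight_le hA hd hp hT i).trans ?_
  rw [← Finset.mul_sum, ← trace_scaledGram_mul, mul_nonsing_inv _ hunit, trace_one,
    Fintype.card_fin]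

theorem trace_scaledGram_averageWeight_mul_le (hA : Function.Injective A.mulVec) (hd : 0 < d)
    (hp : 2 ≤ p) {T : ℕ} (hT : 0 < T) {M : Matrix (Fin d) (Fin d) ℝ} (hM : IsFeasible A p M) :
    (scaledGram A (averageWeight A p T) * M).trace ≤ d := by
  rw [scaledGram_averageWeight, Matrix.sum_mul, trace_sum]
  calc ∑ k ∈ Finset.range T, ((T : ℝ)⁻¹ • weightedGram A p (lewisIter A p k) * M).trace
      ≤ ∑ _k ∈ Finset.range T, (T : ℝ)⁻¹ * (d : ℝ) := Finset.sum_le_sum fun k _ => by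
        rw [smul_mul, trace_smul, smul_eq_mul]
        gcongr
        exact hM.trace_weightedGram_mul_le hp (lewisIter_posOnRows hA hd k).1
          (sum_lewisIter hA hd k).le
    _ = d := by rw [← Finset.sum_mul, sum_range_inv hT, one_mul]

theorem trace_inv_averageWeight_mul_le (hA : Function.Injective A.mulVec) (hd : 0 < d)
    (hp : 2 ≤ p) {T : ℕ} (hT : 0 < T) {w : Fin n → ℝ} (hw : IsLewisWeights A p w) :
    ((scaledGram A (averageWeight A p T))⁻¹ * weightedGram A p w).trace ≤
      Real.exp (Real.log n / T) * d := by
  have hd' : (0 : ℝ) < d := Nat.cast_pos.mpr hd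
  have hδ : 0 ≤ Real.log n / T := div_nonneg (Real.log_natCast_nonneg n) T.cast_nonneg
  rw [Matrix.trace_mul_comm]
  refine (trace_weightedGram_mul_le_of_rpowSum_le hp hw.1 hw.sum_eq.le hd
    (scaledGram_averageWeight_posDef hA hd hT).inv.posSemidef (by positivity)
    (rpowSum_inv_averageWeight_le hA hd hp hT)).trans ?_
  rw [mul_div_cancel_right₀ _ hd'.ne', ← Real.exp_mul]
  gcongr
  calc (p / 2 - 1) * (Real.log n / T) * (2 / p) = (1 - 2 / p) * (Real.log n / T) := by
        have : p ≠ 0 := by linarith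
        field_simp
    _ ≤ Real.log n / T := mul_le_of_le_one_left hδ (sub_le_self _ (by positivity))

theorem loewnerApprox_inv_averageWeight (hA : Function.Injective A.mulVec) (hd : 0 < d)
    (hp : 2 ≤ p) {T : ℕ} (hT : 0 < T) {w : Fin n → ℝ} (hw : IsLewisWeights A p w) {β : ℝ}
    (hβ : 1 ≤ β) (hlog : Real.log n ≤ T) (hdlog : 2 * d * Real.log n ≤ T * (β + β⁻¹ - 2)) :
    LoewnerApprox β (scaledGram A (averageWeight A p T))⁻¹ (weightedGram A p w)⁻¹ := by
  have hT' : (0 : ℝ) < T := Nat.cast_pos.mpr hT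
  set δ := Real.log n / T
  have hδ : 0 ≤ δ := div_nonneg (Real.log_natCast_nonneg n) hT'.le
  have hexp : Real.exp δ ≤ 1 + 2 * δ := by
    have hδ1 : |δ| ≤ 1 := by rwa [abs_of_nonneg hδ, div_le_one hT']
    have := (le_abs_self _).trans (Real.abs_exp_sub_one_le hδ1)
    rw [abs_of_nonneg hδ] at this
    linarith
  have hdδ : 2 * d * δ ≤ β + β⁻¹ - 2 := by
    rw [← mul_div_assoc, div_le_iff₀ hT', mul_comm (β + β⁻¹ - 2)]
    exact hdlog
  have hG := scaledGram_averageWeight_posDef (p := p) hA hd hT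
  refine loewnerApprox_of_trace_add_trace_le hG.inv hw.posDef.inv hβ ?_
  rw [nonsing_inv_nonsing_inv _ hw.2.1, nonsing_inv_nonsing_inv _ (isUnit_det_of_posDef hG)]
  have hprimal :=
    trace_scaledGram_averageWeight_mul_le hA hd hp hT (hw.isFeasible_inv (by linarith))
  have hdual := (trace_inv_averageWeight_mul_le hA hd hp hT hw).trans
    (mul_le_mul_of_nonneg_right hexp d.cast_nonneg)
  linarith

theorem LoewnerApprox.approx_rpow_quad (hp : 0 < p) {α : ℝ} (hα : 0 < α)
    {M Q : Matrix (Fin d) (Fin d) ℝ} (hM : M.PosSemidef)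
    (h : LoewnerApprox (α ^ (2 / p)) M Q) (a : Fin d → ℝ) :
    Approx α ((a ⬝ᵥ M *ᵥ a) ^ (p / 2)) ((a ⬝ᵥ Q *ᵥ a) ^ (p / 2)) := by
  have hlower := quad_nonneg h.1 a
  have hupper := quad_nonneg h.2 a
  rw [sub_mulVec, dotProduct_sub, smul_mulVec, dotProduct_smul, sub_nonneg, smul_eq_mul]
    at hlower hupper
  have hMa := quad_nonneg hM a
  have hQa : 0 ≤ a ⬝ᵥ Q *ᵥ a := le_trans (by positivity) hlower
  have hα_rpow : ((α ^ (2 / p)) : ℝ) ^ (p / 2) = α := rpow_two_div_rpow hp.ne' hα.le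
  constructor
  · have := Real.rpow_le_rpow (by positivity) hlower (by positivity : 0 ≤ p / 2)
    rwa [Real.mul_rpow (by positivity) hMa, one_div, Real.inv_rpow (by positivity), hα_rpow,
      ← one_div] at this
  · have := Real.rpow_le_rpow hQa hupper (by positivity : 0 ≤ p / 2)
    rwa [Real.mul_rpow (by positivity) hMa, hα_rpow] at this

theorem LoewnerApprox.mono {α β : ℝ} (hα : 0 < α) (hαβ : α ≤ β) {M Q : Matrix (Fin d) (Fin d) ℝ}
    (hM : M.PosSemidef) (h : LoewnerApprox α M Q) : LoewnerApprox β M Q := by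
  have hinv : 0 ≤ 1 / α - 1 / β := sub_nonneg.mpr (one_div_le_one_div_of_le hα hαβ)
  constructor
  · have := h.1.add (hM.smul hinv)
    rwa [sub_smul, sub_add_sub_cancel] at this
  · have := h.2.add (hM.smul (sub_nonneg.mpr hαβ))
    rwa [sub_smul, add_comm, sub_add_sub_cancel] at this

/-- The number of iterations, in units of `d log n`, that suffices for accuracy `ε`. -/
noncomputable def iterationFactor (p ε : ℝ) : ℝ :=
  1 + 2 / ((1 + ε) ^ (2 / p) + ((1 + ε) ^ (2 / p))⁻¹ - 2)

theorem rpow_add_inv_sub_two_pos (hp : 0 < p) {ε : ℝ} (hε : 0 < ε) :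
    0 < (1 + ε) ^ (2 / p) + ((1 + ε) ^ (2 / p))⁻¹ - 2 := by
  have hβ : 1 < (1 + ε) ^ (2 / p) := Real.one_lt_rpow (by linarith) (by positivity)
  rw [add_inv_sub_two_eq (by linarith)]
  exact div_pos (pow_pos (by linarith) 2) (by linarith)

theorem one_le_iterationFactor (hp : 0 < p) {ε : ℝ} (hε : 0 < ε) : 1 ≤ iterationFactor p ε :=
  le_add_of_nonneg_right (div_nonneg zero_le_two (rpow_add_inv_sub_two_pos hp hε).le)

theorem loewnerApprox_rpow_inv_averageWeight (hA : Function.Injective A.mulVec) (hd : 0 < d)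
    (hp : 2 ≤ p) {ε : ℝ} (hε : 0 < ε) {T : ℕ} (hT : 0 < T)
    (hTκ : iterationFactor p ε * (d * Real.log n) ≤ T) {w : Fin n → ℝ}
    (hw : IsLewisWeights A p w) :
    LoewnerApprox ((1 + ε) ^ (2 / p)) (scaledGram A (averageWeight A p T))⁻¹
      (weightedGram A p w)⁻¹ := by
  have hη := rpow_add_inv_sub_two_pos (p := p) (by linarith) hε
  have hβ : 1 ≤ (1 + ε) ^ (2 / p) := Real.one_le_rpow (by linarith) (by positivity)
  rw [iterationFactor] at hTκ
  set η := (1 + ε) ^ (2 / p) + ((1 + ε) ^ (2 / p))⁻¹ - 2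
  have hlog : 0 ≤ Real.log n := Real.log_natCast_nonneg n
  have hdlog : Real.log n ≤ d * Real.log n := le_mul_of_one_le_left hlog (mod_cast hd)
  have hηlog : 0 ≤ 2 / η * (d * Real.log n) := by positivity
  rw [add_mul, one_mul] at hTκ
  refine loewnerApprox_inv_averageWeight hA hd hp hT hw hβ (by linarith) ?_
  have : 2 * (d * Real.log n) ≤ T * η := by
    rw [← div_le_iff₀ hη, mul_div_right_comm]
    linarith
  linarith

theorem loewnerApprox_averageWeight (hA : Function.Injective A.mulVec) (hd : 0 < d)
    (hp : 2 ≤ p) {ε : ℝ} (hε : 0 < ε) {T : ℕ} (hT : 0 < T)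
    (hTκ : iterationFactor p ε * (d * Real.log n) ≤ T) {w : Fin n → ℝ}
    (hw : IsLewisWeights A p w) :
    LoewnerApprox (1 + ε) (scaledGram A (averageWeight A p T))⁻¹ (weightedGram A p w)⁻¹ := by
  have hmono : (1 + ε) ^ (2 / p) ≤ 1 + ε := by
    conv_rhs => rw [← Real.rpow_one (1 + ε)]
    exact Real.rpow_le_rpow_of_exponent_le (by linarith) ((div_le_one (by linarith)).mpr hp)
  exact (loewnerApprox_rpow_inv_averageWeight hA hd hp hε hT hTκ hw).mono
    (by positivity) hmono (scaledGram_averageWeight_posDef hA hd hT).inv.posSemidef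

theorem approx_rpow_quad_averageWeight (hA : Function.Injective A.mulVec) (hd : 0 < d)
    (hp : 2 ≤ p) {ε : ℝ} (hε : 0 < ε) {T : ℕ} (hT : 0 < T)
    (hTκ : iterationFactor p ε * (d * Real.log n) ≤ T) {w : Fin n → ℝ}
    (hw : IsLewisWeights A p w) (i : Fin n) :
    Approx (1 + ε) ((A i ⬝ᵥ (scaledGram A (averageWeight A p T))⁻¹ *ᵥ A i) ^ (p / 2)) (w i) := by
  rw [hw.eq_rpow (by linarith) i]
  exact (loewnerApprox_rpow_inv_averageWeight hA hd hp hε hT hTκ hw).approx_rpow_quad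
    (by linarith) (by linarith) (scaledGram_averageWeight_posDef hA hd hT).inv.posSemidef (A i)

end Iteration

/-! ### Inversion by rank one corrections -/

section PartialInverse

variable {m : Type*} [Fintype m] [DecidableEq m] {X N : Matrix m m ℝ} {s : Set m} {k : m}

/-- `N` inverts `X` on the coordinate subspace indexed by `s`, and vanishes on the complementary
coordinates. -/
structure IsPartialInverse (X : Matrix m m ℝ) (s : Set m) (N : Matrix m m ℝ) : Prop where
  transpose_eq : Nᵀ = N
  apply_eq_zero : ∀ i ∉ s, ∀ j, N i j = 0
  mulVec_col : ∀ j ∈ s, N *ᵥ X.col j = Pi.single j 1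

/-- The amount by which `N * X` fails to fix the `k`-th basis vector. -/
def inverseResidual (X : Matrix m m ℝ) (k : m) (N : Matrix m m ℝ) : m → ℝ :=
  N *ᵥ X.col k - Pi.single k 1

/-- The rank one correction of `N` that adds `k` to the indices on which `N` inverts `X`. -/
noncomputable def inverseStep (X : Matrix m m ℝ) (k : m) (N : Matrix m m ℝ) : Matrix m m ℝ :=
  N - (inverseResidual X k N ⬝ᵥ X.col k)⁻¹ •
    vecMulVec (inverseResidual X k N) (inverseResidual X k N)

theorem isPartialInverse_empty (X : Matrix m m ℝ) : IsPartialInverse X ∅ 0 :=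
  ⟨transpose_zero, fun _ _ _ => rfl, fun _ h => h.elim⟩

theorem IsPartialInverse.eq_inv (h : IsPartialInverse X Set.univ N) : N = X⁻¹ := by
  refine (inv_eq_left_inv (ext_of_mulVec_single fun j => ?_)).symm
  rw [← mulVec_mulVec, mulVec_single_one, one_mulVec, h.mulVec_col j trivial]

theorem IsPartialInverse.inverseResidual_apply (h : IsPartialInverse X s N) {i : m} (hi : i ∉ s) :
    inverseResidual X k N i = -(Pi.single k 1 : m → ℝ) i := by
  have hrow : (N *ᵥ X.col k) i = 0 :=
    Finset.sum_eq_zero fun j _ => mul_eq_zero_of_left (h.apply_eq_zero i hi j) _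
  rw [inverseResidual, Pi.sub_apply, hrow, zero_sub]

theorem IsPartialInverse.inverseResidual_dotProduct_col (h : IsPartialInverse X s N)
    (hX : Xᵀ = X) {j : m} (hj : j ∈ s) : inverseResidual X k N ⬝ᵥ X.col j = 0 := by
  have hN : (N *ᵥ X.col k) ⬝ᵥ X.col j = X k j := by
    rw [dotProduct_comm, dotProduct_mulVec, ← mulVec_transpose, h.transpose_eq, h.mulVec_col j hj,
      single_one_dotProduct, col_apply, ← transpose_apply X, hX]
  rw [inverseResidual, sub_dotProduct, hN, single_one_dotProduct, col_apply, sub_self]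

theorem IsPartialInverse.inverseResidual_dotProduct_col_self_neg (h : IsPartialInverse X s N)
    (hX : X.PosDef) (hk : k ∉ s) : inverseResidual X k N ⬝ᵥ X.col k < 0 := by
  set u := inverseResidual X k N with hu
  have huk : u k = -1 := by rw [hu, h.inverseResidual_apply hk, Pi.single_eq_same]
  have hquad : u ⬝ᵥ X *ᵥ u = -(u ⬝ᵥ X.col k) := by
    rw [dotProduct_mulVec]
    refine (Finset.sum_eq_single k (fun j _ hjk => ?_) fun hk =>
      (hk (Finset.mem_univ k)).elim).trans (by rw [huk, mul_neg_one]; rfl)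
    by_cases hj : j ∈ s
    · exact mul_eq_zero_of_left (h.inverseResidual_dotProduct_col
        (transpose_eq_of_posSemidef hX.posSemidef) hj) _
    · rw [hu, h.inverseResidual_apply hj, Pi.single_eq_of_ne hjk, neg_zero, mul_zero]
  have hu_ne : u ≠ 0 := fun h0 => by simp [h0] at huk
  linarith [quad_pos hX hu_ne]

theorem inverseStep_mulVec (X N : Matrix m m ℝ) (k : m) (v : m → ℝ) :
    inverseStep X k N *ᵥ v =
      N *ᵥ v - ((inverseResidual X k N ⬝ᵥ X.col k)⁻¹ * (inverseResidual X k N ⬝ᵥ v)) •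
        inverseResidual X k N := by
  rw [inverseStep, sub_mulVec, smul_mulVec, vecMulVec_mulVec, op_smul_eq_smul, smul_smul]

theorem IsPartialInverse.insert (h : IsPartialInverse X s N) (hX : X.PosDef) (hk : k ∉ s) :
    IsPartialInverse X (insert k s) (inverseStep X k N) where
  transpose_eq := by
    rw [inverseStep, transpose_sub, transpose_smul, transpose_vecMulVec,
      h.transpose_eq]
  apply_eq_zero i hi j := by
    rw [Set.mem_insert_iff, not_or] at hi
    rw [inverseStep, Matrix.sub_apply, Matrix.smul_apply, vecMulVec_apply,
      h.apply_eq_zero i hi.2, h.inverseResidual_apply hi.2, Pi.single_eq_of_ne hi.1, neg_zero,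
      zero_mul, smul_zero, sub_zero]
  mulVec_col := by
    rintro j (rfl | hj)
    · rw [inverseStep_mulVec, inv_mul_cancel₀ (h.inverseResidual_dotProduct_col_self_neg hX hk).ne,
        one_smul, inverseResidual, sub_sub_cancel]
    · rw [inverseStep_mulVec, h.inverseResidual_dotProduct_col
        (transpose_eq_of_posSemidef hX.posSemidef) hj, mul_zero, zero_smul, sub_zero,
        h.mulVec_col j hj]

end PartialInverse

end LewisWeights

namespace RealRAM

open Matrix LewisWeights

/-! ### Total correctness with step counts -/

/-- Total correctness with a running time: started in the memory `σ`, the program `P` halts after at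
most `c` steps in a memory that satisfies `Q`. -/
def HaltsWithin (P : Program) (c : ℕ) (σ : State) (Q : State → Prop) : Prop :=
  ∃ t τ, t ≤ c ∧ Runs P σ t τ ∧ Q τ

theorem HaltsWithin.mono {P : Program} {c c' : ℕ} {σ : State} {Q Q' : State → Prop}
    (h : HaltsWithin P c σ Q) (hc : c ≤ c') (hQ : ∀ τ, Q τ → Q' τ) : HaltsWithin P c' σ Q' := by
  obtain ⟨t, τ, ht, hrun, hτ⟩ := h
  exact ⟨t, τ, ht.trans hc, hrun, hQ τ hτ⟩

theorem HaltsWithin.setNat {x : ℕ} {e : NExp} {σ : State} :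
    HaltsWithin (.setNat x e) (e.cost + 1) σ (· = σ.setNat x (e.eval σ)) :=
  ⟨_, _, le_rfl, .setNat σ x e, rfl⟩

theorem HaltsWithin.seq {P₁ P₂ : Program} {c₁ c₂ : ℕ} {σ : State} {Q₁ Q₂ : State → Prop}
    (h₁ : HaltsWithin P₁ c₁ σ Q₁) (h₂ : ∀ τ, Q₁ τ → HaltsWithin P₂ c₂ τ Q₂) :
    HaltsWithin (.seq P₁ P₂) (c₁ + c₂) σ Q₂ := by
  obtain ⟨t₁, σ₁, ht₁, hrun₁, hσ₁⟩ := h₁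
  obtain ⟨t₂, σ₂, ht₂, hrun₂, hσ₂⟩ := h₂ σ₁ hσ₁
  exact ⟨t₁ + t₂, σ₂, Nat.add_le_add ht₁ ht₂, .seq hrun₁ hrun₂, hσ₂⟩

theorem HaltsWithin.loop {b : BExp} {P : Program} {c N : ℕ} (I : ℕ → State → Prop)
    (hstep : ∀ k < N, ∀ σ, I k σ → b.eval σ ∧ HaltsWithin P c σ (I (k + 1)))
    (hdone : ∀ σ, I N σ → ¬ b.eval σ) {σ : State} (h0 : I 0 σ) :
    HaltsWithin (.loop b P) (N * (b.cost + 1 + c) + (b.cost + 1)) σ (I N) := by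
  suffices H : ∀ m k, k + m = N → ∀ σ, I k σ →
      HaltsWithin (.loop b P) (m * (b.cost + 1 + c) + (b.cost + 1)) σ (I N) from
    H N 0 (Nat.zero_add N) σ h0
  intro m
  induction m with
  | zero =>
    rintro k rfl σ hσ
    exact ⟨_, σ, by omega, .loopFalse (hdone σ hσ), hσ⟩
  | succ m ih =>
    intro k hk σ hσ
    obtain ⟨hb, t₁, σ₁, ht₁, hrun₁, hσ₁⟩ := hstep k (by omega) σ hσ
    obtain ⟨t₂, σ₂, ht₂, hrun₂, hσ₂⟩ := ih (k + 1) (by omega) σ₁ hσ₁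
    refine ⟨_, σ₂, ?_, .loopTrue hb hrun₁ hrun₂, hσ₂⟩
    rw [Nat.succ_mul]
    omega

/-- The contents of all arrays: `ρ a i j` is the entry `[i, j]` of array `a`. -/
abbrev Store := ℕ → ℕ → ℕ → ℝ

/-- Total correctness with a running time, for a program that restores all registers. -/
def Computes (P : Program) (c : ℕ) (ν : ℕ → ℕ) (ρ : Store) (Q : Store → Prop) : Prop :=
  HaltsWithin P c ⟨ν, ρ⟩ fun τ => τ.nat = ν ∧ Q τ.real

section Computes

variable {P P₁ P₂ body : Program} {c c' c₁ c₂ : ℕ} {ν : ℕ → ℕ} {ρ : Store}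
  {Q Q' Q₁ Q₂ : Store → Prop}

theorem Computes.mono (h : Computes P c ν ρ Q) (hc : c ≤ c') (hQ : ∀ ρ', Q ρ' → Q' ρ') :
    Computes P c' ν ρ Q' :=
  HaltsWithin.mono h hc fun _ hτ => hτ.imp_right (hQ _)

theorem Computes.seq (h₁ : Computes P₁ c₁ ν ρ Q₁)
    (h₂ : ∀ ρ', Q₁ ρ' → Computes P₂ c₂ ν ρ' Q₂) : Computes (.seq P₁ P₂) (c₁ + c₂) ν ρ Q₂ :=
  HaltsWithin.seq h₁ fun ⟨_, ρ'⟩ ⟨hν, hρ'⟩ => hν ▸ h₂ ρ' hρ'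

/-- Overwrite one array entry. -/
noncomputable def put (ρ : Store) (a i j : ℕ) (v : ℝ) : Store :=
  Function.update ρ a (Function.update (ρ a) i (Function.update (ρ a i) j v))

theorem put_of_ne (ρ : Store) {a b : ℕ} (h : b ≠ a) (i j : ℕ) (v : ℝ) : put ρ a i j v b = ρ b :=
  Function.update_of_ne h _ _

theorem put_apply (ρ : Store) (a i j : ℕ) (v : ℝ) (i' j' : ℕ) :
    put ρ a i j v a i' j' = if i' = i ∧ j' = j then v else ρ a i' j' := by
  by_cases hi : i' = i <;> by_cases hj : j' = j <;> simp [put, hi, hj]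

theorem put_self (ρ : Store) (a i j : ℕ) (v : ℝ) : put ρ a i j v a i j = v := by
  rw [put_apply, if_pos ⟨rfl, rfl⟩]

theorem put_put (ρ : Store) (a i j : ℕ) (v v' : ℝ) :
    put (put ρ a i j v) a i j v' = put ρ a i j v' := by
  simp only [put, Function.update_self, Function.update_idem]

theorem Computes.setReal {a : ℕ} {i j : NExp} {e : RExp} :
    Computes (.setReal a i j e) (i.cost + j.cost + e.cost + 1) ν ρ
      (· = put ρ a (i.eval ⟨ν, ρ⟩) (j.eval ⟨ν, ρ⟩) (e.eval ⟨ν, ρ⟩)) :=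
  ⟨_, _, le_rfl, .setReal _ a i j e, rfl, rfl⟩

/-- `for x < y do body`, where `x` and `y` are registers. The counter `x` has to be zero initially,
and is reset to zero. -/
def forLoop (x y : ℕ) (body : Program) : Program :=
  .seq (.loop (.neg (.natLe (.reg y) (.reg x)))
    (.seq body (.setNat x (.add (.reg x) (.const 1))))) (.setNat x (.const 0))

theorem Computes.forLoop {x y : ℕ} (hx : ν x = 0) (hy : 0 < ν y) (I : ℕ → Store → Prop)
    (h0 : I 0 ρ)
    (hstep : ∀ k < ν y, ∀ ρ', I k ρ' → Computes body c (Function.update ν x k) ρ' (I (k + 1))) :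
    Computes (forLoop x y body) (ν y * (c + 16)) ν ρ (I (ν y)) := by
  have hyx : y ≠ x := fun h => by rw [h, hx] at hy; exact hy.false
  have hν : Function.update ν x 0 = ν := by rw [← hx, Function.update_eq_self]
  have hloop := HaltsWithin.loop (b := .neg (.natLe (.reg y) (.reg x)))
    (P := .seq body (.setNat x (.add (.reg x) (.const 1)))) (c := c + 4) (N := ν y)
    (fun k σ => σ.nat = Function.update ν x k ∧ I k σ.real) (σ := ⟨ν, ρ⟩)
    (by
      rintro k hk ⟨_, ρ'⟩ ⟨rfl, hI⟩
      refine ⟨by simpa [BExp.eval, NExp.eval, hyx] using hk,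
        HaltsWithin.seq (hstep k hk ρ' hI) fun ⟨_, _⟩ ⟨hν', hI'⟩ => ?_⟩
      subst hν'
      exact HaltsWithin.setNat.mono le_rfl (by rintro _ rfl; simp [State.setNat, NExp.eval, hI']))
    (by rintro ⟨_, _⟩ ⟨rfl, -⟩; simp [BExp.eval, NExp.eval, hyx]) ⟨hν.symm, h0⟩
  refine (hloop.seq (c₂ := 2) fun ⟨_, ρ'⟩ ⟨hν', hI⟩ => HaltsWithin.setNat.mono le_rfl ?_).mono
    ?_ fun _ h => h
  · rintro _ rfl
    subst hν'
    exact ⟨by simp [State.setNat, NExp.eval, hν], hI⟩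
  · simp only [BExp.cost, NExp.cost]
    nlinarith

/-- `a[i, j] := ∑ x < y, e`. -/
def sumInto (a : ℕ) (i j : NExp) (x y : ℕ) (e : RExp) : Program :=
  .seq (.setReal a i j (.const 0)) (forLoop x y (.setReal a i j (.add (.get a i j) e)))

theorem Computes.sumInto {a x y I J N : ℕ} {i j : NExp} {e : RExp} (hx : ν x = 0) (hy : ν y = N)
    (hN : 0 < N) (hi : ∀ k ρ', i.eval ⟨Function.update ν x k, ρ'⟩ = I)
    (hj : ∀ k ρ', j.eval ⟨Function.update ν x k, ρ'⟩ = J) (f : Fin N → ℝ)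
    (he : ∀ (k : Fin N) s, e.eval ⟨Function.update ν x k, put ρ a I J s⟩ = f k) :
    Computes (sumInto a i j x y e) (N * (3 * i.cost + 3 * j.cost + e.cost + 21)) ν ρ
      (· = put ρ a I J (∑ k, f k)) := by
  subst hy
  have hν : Function.update ν x 0 = ν := by rw [← hx, Function.update_eq_self]
  have hi0 := hi 0 ρ
  have hj0 := hj 0 ρ
  rw [hν] at hi0 hj0
  set g : ℕ → ℝ := fun k => if h : k < ν y then f ⟨k, h⟩ else 0
  have hsum : ∑ k ∈ Finset.range (ν y), g k = ∑ k, f k := by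
    rw [Finset.sum_range]
    exact Finset.sum_congr rfl fun k _ => dif_pos k.2
  have hloop : ∀ ρ', ρ' = put ρ a I J 0 → Computes
      (RealRAM.forLoop x y (.setReal a i j (.add (.get a i j) e)))
      (ν y * (i.cost + j.cost + (RExp.add (.get a i j) e).cost + 1 + 16)) ν ρ'
      (· = put ρ a I J (∑ k ∈ Finset.range (ν y), g k)) := fun ρ' hρ' => by
    refine Computes.forLoop hx hN (fun m ρ' => ρ' = put ρ a I J (∑ k ∈ Finset.range m, g k))
      hρ' ?_
    rintro k hk _ rfl
    refine Computes.setReal.mono le_rfl ?_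
    rintro _ rfl
    simp only [RExp.eval, hi, hj, he ⟨k, hk⟩, put_self, put_put, Finset.sum_range_succ, g,
      dif_pos hk]
  rw [← hsum]
  refine (Computes.seq (Computes.setReal.mono le_rfl ?_) hloop).mono ?_ fun _ h => h
  · rintro _ rfl
    rw [hi0, hj0, RExp.eval, Rat.cast_zero]
  · simp only [RExp.cost]
    nlinarith

end Computes

/-! ### Filling vectors and matrices -/

section Fill

/-- The stores `ρ` and `ρ'` agree on all arrays outside `s`. -/
def AgreeOff (s : Finset ℕ) (ρ ρ' : Store) : Prop :=
  ∀ b ∉ s, ρ' b = ρ b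

theorem AgreeOff.trans {s₁ s₂ : Finset ℕ} {ρ₁ ρ₂ ρ₃ : Store} (h₁ : AgreeOff s₁ ρ₁ ρ₂)
    (h₂ : AgreeOff s₂ ρ₂ ρ₃) : AgreeOff (s₁ ∪ s₂) ρ₁ ρ₃ := fun b hb => by
  rw [Finset.mem_union, not_or] at hb
  rw [h₂ b hb.2, h₁ b hb.1]

theorem AgreeOff.mono {s s' : Finset ℕ} {ρ ρ' : Store} (h : AgreeOff s ρ ρ') (hs : s ⊆ s') :
    AgreeOff s' ρ ρ' :=
  fun b hb => h b fun hb' => hb (hs hb')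

theorem agreeOff_put (ρ : Store) (a i j : ℕ) (v : ℝ) : AgreeOff {a} ρ (put ρ a i j v) :=
  fun _ hb => put_of_ne ρ (Finset.notMem_singleton.mp hb) i j v

/-- The vector of length `N` in column `0` of array `a`. -/
def vectorAt (ρ : Store) (a N : ℕ) : Fin N → ℝ :=
  fun i => ρ a i 0

/-- The `N × M` matrix in array `a`. -/
def matrixAt (ρ : Store) (a N M : ℕ) : Matrix (Fin N) (Fin M) ℝ :=
  of fun i j => ρ a i j

theorem AgreeOff.vectorAt_eq {s : Finset ℕ} {ρ ρ' : Store} (h : AgreeOff s ρ ρ') {a : ℕ}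
    (ha : a ∉ s) (N : ℕ) : vectorAt ρ' a N = vectorAt ρ a N := by
  unfold vectorAt
  rw [h a ha]

theorem AgreeOff.matrixAt_eq {s : Finset ℕ} {ρ ρ' : Store} (h : AgreeOff s ρ ρ') {a : ℕ}
    (ha : a ∉ s) (N M : ℕ) : matrixAt ρ' a N M = matrixAt ρ a N M := by
  unfold matrixAt
  rw [h a ha]

/-- `ρ'` arises from `ρ` by overwriting the entries of array `a` with indices in `S` by those of
`F`. -/
structure Fills {N M : ℕ} (a : ℕ) (F : Matrix (Fin N) (Fin M) ℝ) (S : Set (Fin N × Fin M))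
    (ρ ρ' : Store) : Prop where
  agreeOff : AgreeOff {a} ρ ρ'
  apply_of_mem : ∀ i j, (i, j) ∈ S → ρ' a i j = F i j
  apply_of_notMem : ∀ i j, (i, j) ∉ S → ρ' a i j = ρ a i j

variable {N M : ℕ} {a : ℕ} {F : Matrix (Fin N) (Fin M) ℝ} {S : Set (Fin N × Fin M)} {ρ ρ' : Store}

theorem fills_empty : Fills a F ∅ ρ ρ :=
  ⟨fun _ _ => rfl, fun _ _ h => h.elim, fun _ _ _ => rfl⟩

theorem Fills.put (h : Fills a F S ρ ρ') (i : Fin N) (j : Fin M) :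
    Fills a F (insert (i, j) S) ρ (RealRAM.put ρ' a i j (F i j)) where
  agreeOff b hb := (agreeOff_put ρ' a i j _ b hb).trans (h.agreeOff b hb)
  apply_of_mem i' j' h' := by
    rw [put_apply]
    simp only [Fin.val_inj]
    split_ifs with heq
    · rw [heq.1, heq.2]
    · exact h.apply_of_mem i' j' (h'.resolve_left fun h'' => heq (Prod.mk.inj h''))
  apply_of_notMem i' j' h' := by
    rw [Set.mem_insert_iff, not_or, Prod.mk.injEq] at h'
    rw [put_apply, if_neg (by simpa only [Fin.val_inj] using h'.1), h.apply_of_notMem i' j' h'.2]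

end Fill

/-- The registers assumed by the loops below: `0` and `1` hold the positive dimensions, and the loop
counters `2`, `3`, `4` are zero. -/
structure Ready (n d : ℕ) (ν : ℕ → ℕ) : Prop where
  rows_pos : 0 < n
  cols_pos : 0 < d
  rows : ν 0 = n
  cols : ν 1 = d
  counter : ∀ x, 2 ≤ x → x ≤ 4 → ν x = 0

variable {n d : ℕ} {ν : ℕ → ℕ} {ρ : Store}

theorem Ready.update (hν : Ready n d ν) {x : ℕ} (hx : 5 ≤ x) (k : ℕ) :
    Ready n d (Function.update ν x k) where
  rows_pos := hν.rows_pos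
  cols_pos := hν.cols_pos
  rows := by rw [Function.update_of_ne (by omega), hν.rows]
  cols := by rw [Function.update_of_ne (by omega), hν.cols]
  counter y hy hy' := by rw [Function.update_of_ne (by omega), hν.counter y hy hy']

theorem Ready.pow_mul_pow_le (hν : Ready n d ν) {a b : ℕ} (ha : a ≤ 1) (hb : b ≤ 3) :
    n ^ a * d ^ b ≤ n * d ^ 3 :=
  Nat.mul_le_mul ((Nat.pow_le_pow_right hν.rows_pos ha).trans_eq (pow_one n))
    (Nat.pow_le_pow_right hν.cols_pos hb)

/-- `for i < r do body`, with `i` in register `2`. -/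
def rowLoop (r : ℕ) (body : Program) : Program :=
  forLoop 2 r body

/-- `for i < r, j < d do body`, with `i` and `j` in registers `2` and `3`. -/
def entryLoop (r : ℕ) (body : Program) : Program :=
  forLoop 2 r (forLoop 3 1 body)

section Loops

variable {N r a c : ℕ} {body : Program}

theorem Computes.rowLoop (hν : Ready n d ν) (hr : ν r = N) (hN : 0 < N) (v : Fin N → ℝ)
    (hbody : ∀ (i : Fin N) ρ', AgreeOff {a} ρ ρ' → ρ' a i 0 = ρ a i 0 →
      Computes body c (Function.update ν 2 i) ρ' (· = put ρ' a i 0 (v i))) :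
    Computes (rowLoop r body) (N * (c + 16)) ν ρ
      fun ρ' => AgreeOff {a} ρ ρ' ∧ vectorAt ρ' a N = v := by
  subst hr
  let F : Matrix (Fin (ν r)) (Fin 1) ℝ := of fun i _ => v i
  refine (Computes.forLoop (hν.counter 2 le_rfl (by norm_num)) hN
    (fun k => Fills a F {q | q.1 < k} ρ) ?_ ?_).mono le_rfl ?_
  · simpa using fills_empty
  · intro k hk ρ' hρ'
    refine (hbody ⟨k, hk⟩ ρ' hρ'.agreeOff
      (hρ'.apply_of_notMem ⟨k, hk⟩ 0 (lt_irrefl k))).mono le_rfl ?_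
    rintro _ rfl
    convert hρ'.put ⟨k, hk⟩ 0 using 1
    · ext ⟨i, j⟩
      simp only [Set.mem_ofPred_eq, Set.mem_insert_iff, Prod.mk.injEq, Fin.ext_iff]
      omega
    · rfl
  · exact fun ρ' hρ' => ⟨hρ'.agreeOff, funext fun i => hρ'.apply_of_mem i 0 i.2⟩

theorem Computes.entryLoop (hν : Ready n d ν) (hr : ν r = N) (hN : 0 < N)
    (F : Matrix (Fin N) (Fin d) ℝ)
    (hbody : ∀ (i : Fin N) (j : Fin d) ρ', AgreeOff {a} ρ ρ' → ρ' a i j = ρ a i j →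
      Computes body c (Function.update (Function.update ν 2 i) 3 j) ρ' (· = put ρ' a i j (F i j))) :
    Computes (entryLoop r body) (N * d * (c + 32)) ν ρ
      fun ρ' => AgreeOff {a} ρ ρ' ∧ matrixAt ρ' a N d = F := by
  obtain ⟨-, hd, -, rfl, hcounter⟩ := hν
  subst hr
  refine (Computes.forLoop (hcounter 2 le_rfl (by norm_num)) hN
    (fun k => Fills a F {q | q.1 < k} ρ) ?_ fun k hk ρ' hρ' => ?_).mono
    (c := ν r * (ν 1 * (c + 16) + 16)) ?_ ?_
  · simpa using fills_empty
  · have hinner := Computes.forLoop (x := 3) (y := 1) (ν := Function.update ν 2 k) (ρ := ρ')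
      (body := body) (c := c) (hcounter 3 (by norm_num) (by norm_num)) hd
      (fun l => Fills a F {q | (q.1 : ℕ) < k ∨ (q.1 : ℕ) = k ∧ q.2 < l} ρ) (by simpa using hρ') ?_
    · refine hinner.mono le_rfl fun ρ'' h => ?_
      convert h using 1
      ext ⟨i, j⟩
      have := j.2
      simp only [Set.mem_ofPred_eq, ne_eq, OfNat.one_ne_ofNat, not_false_eq_true,
        Function.update_of_ne]
      omega
    · intro l hl ρ'' hρ''
      refine (hbody ⟨k, hk⟩ ⟨l, hl⟩ ρ'' hρ''.agreeOff
        (hρ''.apply_of_notMem ⟨k, hk⟩ ⟨l, hl⟩ (by simp))).mono le_rfl ?_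
      rintro _ rfl
      convert hρ''.put ⟨k, hk⟩ ⟨l, hl⟩ using 1
      ext ⟨i, j⟩
      simp only [Set.mem_ofPred_eq, Set.mem_insert_iff, Prod.mk.injEq, Fin.ext_iff]
      omega
  · nlinarith [Nat.mul_le_mul_left (ν r) hd]
  · exact fun ρ' hρ' => ⟨hρ'.agreeOff, by ext i j; exact hρ'.apply_of_mem i j i.2⟩

end Loops

section Fill

variable {N K r s a : ℕ} {e : RExp}

/-- `a[i, 0] := e` for `i < r`. -/
def fillVector (a r : ℕ) (e : RExp) : Program :=
  rowLoop r (.setReal a (.reg 2) (.const 0) e)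

/-- `a[i, j] := e` for `i < r`, `j < d`. -/
def fillMatrix (a r : ℕ) (e : RExp) : Program :=
  entryLoop r (.setReal a (.reg 2) (.reg 3) e)

/-- `a[i, 0] := ∑ k < s, e` for `i < r`, with `k` in register `4`. -/
def sumVector (a r s : ℕ) (e : RExp) : Program :=
  rowLoop r (sumInto a (.reg 2) (.const 0) 4 s e)

/-- `a[i, j] := ∑ k < s, e` for `i < r`, `j < d`, with `k` in register `4`. -/
def sumMatrix (a r s : ℕ) (e : RExp) : Program :=
  entryLoop r (sumInto a (.reg 2) (.reg 3) 4 s e)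

theorem Computes.fillVector (hν : Ready n d ν) (hr : ν r = N) (hN : 0 < N) (v : Fin N → ℝ)
    (he : ∀ (i : Fin N) ρ', AgreeOff {a} ρ ρ' → ρ' a i 0 = ρ a i 0 →
      e.eval ⟨Function.update ν 2 i, ρ'⟩ = v i) :
    Computes (fillVector a r e) (N * (e.cost + 19)) ν ρ
      fun ρ' => AgreeOff {a} ρ ρ' ∧ vectorAt ρ' a N = v := by
  refine (Computes.rowLoop hν hr hN v fun i ρ' hρ' hi => Computes.setReal.mono le_rfl ?_).mono
    ?_ fun _ h => h
  · rintro _ rfl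
    simp [NExp.eval, he i ρ' hρ' hi]
  · simp only [NExp.cost]
    exact Nat.mul_le_mul_left _ (by omega)

theorem Computes.fillMatrix (hν : Ready n d ν) (hr : ν r = N) (hN : 0 < N)
    (F : Matrix (Fin N) (Fin d) ℝ)
    (he : ∀ (i : Fin N) (j : Fin d) ρ', AgreeOff {a} ρ ρ' → ρ' a i j = ρ a i j →
      e.eval ⟨Function.update (Function.update ν 2 i) 3 j, ρ'⟩ = F i j) :
    Computes (fillMatrix a r e) (N * d * (e.cost + 35)) ν ρ
      fun ρ' => AgreeOff {a} ρ ρ' ∧ matrixAt ρ' a N d = F := by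
  refine (Computes.entryLoop hν hr hN F fun i j ρ' hρ' hij =>
    Computes.setReal.mono le_rfl ?_).mono ?_ fun _ h => h
  · rintro _ rfl
    simp [NExp.eval, he i j ρ' hρ' hij]
  · simp only [NExp.cost]
    exact Nat.mul_le_mul_left _ (by omega)

theorem Computes.sumVector (hν : Ready n d ν) (hr : ν r = N) (hN : 0 < N) (hs : ν s = K)
    (hK : 0 < K) (g : Fin N → Fin K → ℝ)
    (he : ∀ (i : Fin N) (k : Fin K) ρ', AgreeOff {a} ρ ρ' →
      e.eval ⟨Function.update (Function.update ν 2 i) 4 k, ρ'⟩ = g i k) :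
    Computes (sumVector a r s e) (N * K * (e.cost + 43)) ν ρ
      fun ρ' => AgreeOff {a} ρ ρ' ∧ vectorAt ρ' a N = fun i => ∑ k, g i k := by
  have hs2 : s ≠ 2 := by rintro rfl; have := hν.counter 2; omega
  refine (Computes.rowLoop hν hr hN _ fun i ρ' hρ' _ => Computes.sumInto
    (by simpa using hν.counter 4) (by simpa [hs2] using hs) hK (by simp [NExp.eval])
    (by simp [NExp.eval]) (g i) fun k t => he i k _ ?_).mono ?_ fun _ h => h
  · exact fun b hb => (agreeOff_put ρ' a i 0 t b hb).trans (hρ' b hb)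
  · simp only [NExp.cost]
    nlinarith [Nat.mul_le_mul_left N hK]

theorem Computes.sumMatrix (hν : Ready n d ν) (hr : ν r = N) (hN : 0 < N) (hs : ν s = K)
    (hK : 0 < K) (g : Fin N → Fin d → Fin K → ℝ)
    (he : ∀ (i : Fin N) (j : Fin d) (k : Fin K) ρ', AgreeOff {a} ρ ρ' →
      e.eval ⟨Function.update (Function.update (Function.update ν 2 i) 3 j) 4 k, ρ'⟩ = g i j k) :
    Computes (sumMatrix a r s e) (N * d * K * (e.cost + 59)) ν ρ
      fun ρ' => AgreeOff {a} ρ ρ' ∧ matrixAt ρ' a N d = of fun i j => ∑ k, g i j k := by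
  have hs2 : s ≠ 2 := by rintro rfl; have := hν.counter 2; omega
  have hs3 : s ≠ 3 := by rintro rfl; have := hν.counter 3; omega
  refine (Computes.entryLoop hν hr hN _ fun i j ρ' hρ' _ => Computes.sumInto
    (by simpa using hν.counter 4) (by simpa [hs2, hs3] using hs) hK (by simp [NExp.eval])
    (by simp [NExp.eval]) (g i j) fun k t => he i j k _ ?_).mono ?_ fun _ h => h
  · exact fun b hb => (agreeOff_put ρ' a i j t b hb).trans (hρ' b hb)
  · simp only [NExp.cost]
    nlinarith [Nat.mul_le_mul_left (N * d) hK]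

end Fill

local infixl:65 "+ᵣ" => RExp.add
local infixl:65 "-ᵣ" => RExp.sub
local infixl:70 "*ᵣ" => RExp.mul
local infixl:70 "/ᵣ" => RExp.div
local infixr:75 "^ᵣ" => RExp.pow
local infixr:30 ";;" => Program.seq

/-
Arrays: `0` the matrix `A`, `1` the exponent `p`, `2` the accuracy `ε`, `3` the weights and finally
the output vector, `4` the inverse and finally the output matrix, `5` the Gram matrix, `6` and `7`
the residual and pivot of the inverse step, `8` the product of `A` and array `4`, `9` the values
`aᵢᵀ N aᵢ`, where `N` is array `4`, `10` the diagonal `v` of the Gram matrix, `11` the accumulated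
`v`, `12` the iteration factor.

Registers: `0` and `1` the dimensions `n` and `d`, `2` to `4` the counters of the array loops, which
are zero outside them, `5` the column of the inverse step, `6` the logarithm of `n`, `7` the number
of iterations, `8` a power of two.
-/

/-- The entry of array `a` whose indices are in the registers `x` and `y`. -/
abbrev entry (a x y : ℕ) : RExp := .get a (.reg x) (.reg y)

/-- The coordinate, with index in register `x`, of the vector in array `a`. -/
abbrev coord (a x : ℕ) : RExp := .get a (.reg x) (.const 0)

/-- The number in array `a`. -/
abbrev scalar (a : ℕ) : RExp := .get a (.const 0) (.const 0)

/-! ### Inverting a Gram matrix -/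

section Inverse

/-- Array `5` becomes `∑ i, vᵢ aᵢ aᵢᵀ`, where `v` is in array `10`. -/
def gramProgram : Program :=
  sumMatrix 5 1 0 (coord 10 4 *ᵣ entry 0 4 2 *ᵣ entry 0 4 3)

theorem computes_gramProgram (hν : Ready n d ν) :
    Computes gramProgram (d * d * n * 70) ν ρ fun ρ' => AgreeOff {5} ρ ρ' ∧
      matrixAt ρ' 5 d d = scaledGram (matrixAt ρ 0 n d) (vectorAt ρ 10 n) := by
  refine Computes.mono (Computes.sumMatrix hν hν.cols hν.cols_pos hν.rows hν.rows_pos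
    (fun j l i => vectorAt ρ 10 n i * matrixAt ρ 0 n d i j * matrixAt ρ 0 n d i l)
    fun j l i ρ' hρ' => ?_) (by simp [RExp.cost, NExp.cost]) fun ρ' h => ⟨h.1, ?_⟩
  · simp [RExp.eval, NExp.eval, hρ' 0, hρ' 10, vectorAt, matrixAt]
  · rw [h.2]
    ext j l
    rw [scaledGram_apply, of_apply]

/-- Array `6` becomes the residual `N xₖ - eₖ` of the inverse step, where `N` is in array `4`, `xₖ`
is column `k` of the matrix in array `5`, and `k` is in register `5`. -/
def residualProgram : Program :=
  sumVector 6 1 1 (entry 4 2 4 *ᵣ entry 5 4 5) ;;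
  .setReal 6 (.reg 5) (.const 0) (coord 6 5 -ᵣ .const 1)

theorem computes_residualProgram (hν : Ready n d ν) {k : Fin d} (hk : ν 5 = k) :
    Computes residualProgram (d * d * 50 + 8) ν ρ fun ρ' => AgreeOff {6} ρ ρ' ∧
      vectorAt ρ' 6 d = inverseResidual (matrixAt ρ 5 d d) k (matrixAt ρ 4 d d) := by
  refine Computes.mono (Computes.seq (Computes.sumVector hν hν.cols hν.cols_pos hν.cols hν.cols_pos
    (fun i j => matrixAt ρ 4 d d i j * matrixAt ρ 5 d d j k) fun i j ρ' hρ' => ?_) fun ρ' h =>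
      Computes.setReal.mono le_rfl ?_) ?_ fun _ h => h
  · simp [RExp.eval, NExp.eval, hρ' 4, hρ' 5, matrixAt, hk]
  · rintro _ rfl
    refine ⟨fun b hb => (agreeOff_put ρ' _ _ _ _ b hb).trans (h.1 b hb), funext fun i => ?_⟩
    have hi : ρ' 6 i 0 = (matrixAt ρ 4 d d *ᵥ (matrixAt ρ 5 d d).col k) i := congrFun h.2 i
    by_cases hik : i = k
    · subst hik
      simp [vectorAt, inverseResidual, put_apply, RExp.eval, NExp.eval, hk, hi]
    · simp [vectorAt, inverseResidual, put_apply, NExp.eval, hk, hi, Fin.val_inj, hik]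
  · simp only [RExp.cost, NExp.cost]
    omega

/-- Replaces the matrix in array `4` by its rank one correction for the pivot in register `5`. -/
def inverseStepProgram : Program :=
  residualProgram ;;
  sumInto 7 (.const 0) (.const 0) 4 1 (coord 6 4 *ᵣ entry 5 4 5) ;;
  fillMatrix 4 1 (entry 4 2 3 -ᵣ coord 6 2 *ᵣ coord 6 3 /ᵣ scalar 7)

theorem computes_inverseStepProgram (hν : Ready n d ν) {k : Fin d} (hk : ν 5 = k) :
    Computes inverseStepProgram (d * d * 150) ν ρ fun ρ' => AgreeOff {4, 6, 7} ρ ρ' ∧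
      matrixAt ρ' 4 d d = inverseStep (matrixAt ρ 5 d d) k (matrixAt ρ 4 d d) := by
  set u := inverseResidual (matrixAt ρ 5 d d) k (matrixAt ρ 4 d d)
  refine (Computes.seq (computes_residualProgram hν hk) fun ρ₁ h₁ => Computes.seq
    (Computes.sumInto (I := 0) (J := 0) (by simpa using hν.counter 4) hν.cols hν.cols_pos
      (by simp [NExp.eval]) (by simp [NExp.eval])
      (fun j => u j * matrixAt ρ 5 d d j k) fun j t => ?_) fun ρ₂ h₂ =>
    (Computes.fillMatrix hν hν.cols hν.cols_pos
      (inverseStep (matrixAt ρ 5 d d) k (matrixAt ρ 4 d d)) fun i j ρ₃ h₃ hij => ?_).mono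
      le_rfl ?_).mono ?_ fun _ h => h
  · have hu : ρ₁ 6 j 0 = u j := congrFun h₁.2 j
    simp [RExp.eval, NExp.eval, put_of_ne, h₁.1 5, hk, hu, matrixAt]
  · subst h₂
    have hu : ∀ i : Fin d, ρ₁ 6 i 0 = u i := congrFun h₁.2
    rw [put_of_ne _ (by decide), h₁.1 4 (by decide)] at hij
    have hstep : inverseStep (matrixAt ρ 5 d d) k (matrixAt ρ 4 d d) i j =
        ρ 4 i j - u i * u j / ∑ l, u l * matrixAt ρ 5 d d l k := by
      simp only [inverseStep, Matrix.sub_apply, Matrix.smul_apply, vecMulVec_apply, smul_eq_mul,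
        div_eq_inv_mul]
      rfl
    simp [RExp.eval, NExp.eval, h₃ 6, h₃ 7, put_of_ne, put_self, hu, hij, hstep]
  · rintro ρ₃ ⟨h₃, hN⟩
    subst h₂
    exact ⟨(h₁.1.trans ((agreeOff_put _ _ _ _ _).trans h₃)).mono (by decide), hN⟩
  · simp only [RExp.cost, NExp.cost]
    nlinarith [hν.cols_pos]

/-- Array `4` becomes the inverse of the matrix in array `5`. -/
def inverseProgram : Program :=
  fillMatrix 4 1 (.const 0) ;; forLoop 5 1 inverseStepProgram

theorem computes_inverseProgram (hν : Ready n d ν) (h5 : ν 5 = 0)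
    (hX : (matrixAt ρ 5 d d).PosDef) :
    Computes inverseProgram (d * d * 36 + d * (d * d * 150 + 16)) ν ρ fun ρ' =>
      AgreeOff {4, 6, 7} ρ ρ' ∧ matrixAt ρ' 4 d d = (matrixAt ρ 5 d d)⁻¹ := by
  refine Computes.mono (Computes.seq (Computes.fillMatrix hν hν.cols hν.cols_pos 0
    fun i j ρ' _ _ => by simp [RExp.eval]) fun ρ₀ h₀ => ?_) le_rfl fun _ h => h
  have hcols := hν.cols
  have hloop := Computes.forLoop (ν := ν) (ρ := ρ₀) (y := 1) h5 (hcols ▸ hν.cols_pos)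
    (body := inverseStepProgram) (c := d * d * 150)
    (fun k ρ' => AgreeOff {4, 6, 7} ρ ρ' ∧
      IsPartialInverse (matrixAt ρ 5 d d) {j | (j : ℕ) < k} (matrixAt ρ' 4 d d)) ?_ ?_
  · rw [hcols] at hloop
    exact hloop.mono le_rfl fun ρ' h => ⟨h.1, IsPartialInverse.eq_inv (by simpa using h.2)⟩
  · refine ⟨h₀.1.mono (by decide), ?_⟩
    simpa [h₀.2] using isPartialInverse_empty _
  · intro k hk ρ' h
    rw [hcols] at hk
    refine (computes_inverseStepProgram (hν.update le_rfl k) (k := ⟨k, hk⟩) (by simp)).mono le_rfl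
      fun ρ'' h' => ⟨(h.1.trans h'.1).mono (by decide), ?_⟩
    rw [h'.2, h.1.matrixAt_eq (by decide)]
    convert h.2.insert hX (k := ⟨k, hk⟩) (lt_irrefl k) using 1
    ext j
    simp only [Set.mem_ofPred_eq, Set.mem_insert_iff, Fin.ext_iff]
    omega

/-- Array `9` becomes the vector of the `aᵢᵀ N aᵢ`, where `N` is in array `4`. -/
def quadProgram : Program :=
  sumMatrix 8 0 1 (entry 0 2 4 *ᵣ entry 4 4 3) ;;
  sumVector 9 0 1 (entry 8 2 4 *ᵣ entry 0 2 4)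

theorem computes_quadProgram (hν : Ready n d ν) :
    Computes quadProgram (n * d * d * 66 + n * d * 50) ν ρ fun ρ' => AgreeOff {8, 9} ρ ρ' ∧
      vectorAt ρ' 9 n =
        fun i => matrixAt ρ 0 n d i ⬝ᵥ matrixAt ρ 4 d d *ᵥ matrixAt ρ 0 n d i := by
  set A := matrixAt ρ 0 n d
  set N := matrixAt ρ 4 d d
  refine Computes.mono (Computes.seq (Computes.sumMatrix hν hν.rows hν.rows_pos hν.cols hν.cols_pos
    (fun i j k => A i k * N k j) fun i j k ρ' h' => ?_) fun ρ₁ h₁ =>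
    Computes.mono (Computes.sumVector hν hν.rows hν.rows_pos hν.cols hν.cols_pos
      (fun i k => (A * N) i k * A i k) fun i k ρ' h' => ?_) le_rfl fun ρ₂ h₂ =>
        ⟨(h₁.1.trans h₂.1).mono (by decide), ?_⟩) ?_ fun _ h => h
  · simp [RExp.eval, NExp.eval, h' 0, h' 4, A, N, matrixAt]
  · have hAN : ρ₁ 8 i k = (A * N) i k := congrFun₂ h₁.2 i k
    simp [RExp.eval, NExp.eval, h' 0, h' 8, h₁.1 0, hAN, A, matrixAt]
  · simp [RExp.cost, NExp.cost]
  · rw [h₂.2]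
    exact funext fun i => (dotProduct_mulVec _ _ _).symm

/-- Array `4` becomes `X⁻¹` and array `9` becomes the vector of the `aᵢᵀ X⁻¹ aᵢ`, where
`X = ∑ i, vᵢ aᵢ aᵢᵀ` and `v` is in array `10`. -/
def leverageProgram : Program :=
  gramProgram ;; inverseProgram ;; quadProgram

theorem computes_leverageProgram (hν : Ready n d ν) (h5 : ν 5 = 0)
    {A : Matrix (Fin n) (Fin d) ℝ} {v : Fin n → ℝ} (hA : matrixAt ρ 0 n d = A)
    (hv : vectorAt ρ 10 n = v) (hX : (scaledGram A v).PosDef) :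
    Computes leverageProgram (400 * (n * d ^ 3)) ν ρ fun ρ' =>
      AgreeOff {4, 5, 6, 7, 8, 9} ρ ρ' ∧ matrixAt ρ' 4 d d = (scaledGram A v)⁻¹ ∧
        vectorAt ρ' 9 n = fun i => A i ⬝ᵥ (scaledGram A v)⁻¹ *ᵥ A i := by
  subst hA hv
  refine Computes.mono (Computes.seq (computes_gramProgram hν) fun ρ₁ h₁ => Computes.seq
    (computes_inverseProgram hν h5 (by rwa [h₁.2])) fun ρ₂ h₂ => (computes_quadProgram hν).mono
    le_rfl fun ρ₃ h₃ => ⟨(h₁.1.trans (h₂.1.trans h₃.1)).mono (by decide), ?_, ?_⟩) ?_ fun _ h => h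
  · have h1 := hν.pow_mul_pow_le (a := 0) (b := 1) (by simp) (by simp)
    have h2 := hν.pow_mul_pow_le (a := 0) (b := 2) (by simp) (by simp)
    have h3 := hν.pow_mul_pow_le (a := 0) (b := 3) (by simp) (by simp)
    have h11 := hν.pow_mul_pow_le (a := 1) (b := 1) (by simp) (by simp)
    have h12 := hν.pow_mul_pow_le (a := 1) (b := 2) (by simp) (by simp)
    linarith
  · rw [h₃.1.matrixAt_eq (by decide), h₂.2, h₁.2]
  · rw [h₃.2, h₂.2, h₁.2, h₂.1.matrixAt_eq (by decide), h₁.1.matrixAt_eq (by decide)]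

end Inverse

/-! ### The Lewis weight program -/

section Lewis

/-- The arrays after `k` fixed-point iterations: array `3` holds the current weights `w`, array
`11` the sum of the `w ^ (1 - 2 / p)` over the iterations done so far, array `12` the iteration
factor `κ`. -/
structure LoopInvariant (A : Matrix (Fin n) (Fin d) ℝ) (p κ : ℝ) (k : ℕ) (ρ : Store) : Prop where
  matrix : matrixAt ρ 0 n d = A
  exponent : ρ 1 0 0 = p
  factor : ρ 12 0 0 = κ
  weights : vectorAt ρ 3 n = lewisIter A p k
  total : vectorAt ρ 11 n = fun i => ∑ m ∈ Finset.range k, lewisIter A p m i ^ (1 - 2 / p)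

variable {A : Matrix (Fin n) (Fin d) ℝ} {p ε κ : ℝ} {k T : ℕ}

/-- One fixed-point iteration. -/
def iterationProgram : Program :=
  fillVector 10 0 (coord 3 2 ^ᵣ (.const 1 -ᵣ .const 2 /ᵣ scalar 1)) ;;
  fillVector 11 0 (coord 11 2 +ᵣ coord 10 2) ;;
  leverageProgram ;;
  fillVector 3 0 (coord 10 2 *ᵣ coord 9 2)

theorem computes_iterationProgram (hν : Ready n d ν) (h5 : ν 5 = 0)
    (hA : Function.Injective A.mulVec) (hρ : LoopInvariant A p κ k ρ) :
    Computes iterationProgram (500 * (n * d ^ 3)) ν ρ (LoopInvariant A p κ (k + 1)) := by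
  set v : Fin n → ℝ := fun i => lewisIter A p k i ^ (1 - 2 / p)
  refine Computes.mono (Computes.seq (Computes.fillVector hν hν.rows hν.rows_pos v
    fun i ρ' h' _ => ?_) fun ρ₁ h₁ => Computes.seq (Computes.fillVector hν hν.rows hν.rows_pos
    (fun i => ∑ m ∈ Finset.range (k + 1), lewisIter A p m i ^ (1 - 2 / p)) fun i ρ' h' hi => ?_)
    fun ρ₂ h₂ => Computes.seq (computes_leverageProgram hν h5
      (((h₁.1.trans h₂.1).matrixAt_eq (by decide) _ _).trans hρ.matrix)
      ((h₂.1.vectorAt_eq (by decide) _).trans h₁.2)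
      (weightedGram_lewisIter_posDef hA hν.cols_pos k)) fun ρ₃ h₃ =>
    Computes.mono (Computes.fillVector hν hν.rows hν.rows_pos (lewisIter A p (k + 1))
      fun i ρ' h' _ => ?_) le_rfl fun ρ₄ h₄ => ?_) ?_ fun _ h => h
  · have hw : ρ 3 i 0 = lewisIter A p k i := congrFun hρ.weights i
    have hw0 : 0 ≤ lewisIter A p k i := (lewisIter_posOnRows hA hν.cols_pos k).1 i
    simp [RExp.eval, NExp.eval, h' 1, h' 3, hρ.exponent, hw, hw0.not_gt, v]
  · have hs : ρ 11 i 0 = ∑ m ∈ Finset.range k, lewisIter A p m i ^ (1 - 2 / p) :=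
      congrFun hρ.total i
    have hvi : ρ₁ 10 i 0 = v i := congrFun h₁.2 i
    simp [RExp.eval, NExp.eval, hi, h' 10, h₁.1 11, hs, hvi, Finset.sum_range_succ, v]
  · have hvi : ρ₁ 10 i 0 = v i := congrFun h₁.2 i
    have hq : ρ₃ 9 i 0 = A i ⬝ᵥ (scaledGram A v)⁻¹ *ᵥ A i := congrFun h₃.2.2 i
    have hstep : lewisIter A p (k + 1) i = v i * (A i ⬝ᵥ (scaledGram A v)⁻¹ *ᵥ A i) := rfl
    simp [RExp.eval, NExp.eval, h' 9, h' 10, h₃.1 10, h₂.1 10, hvi, hq, hstep]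
  · have h : AgreeOff {3, 4, 5, 6, 7, 8, 9, 10, 11} ρ ρ₄ :=
      (h₁.1.trans (h₂.1.trans (h₃.1.trans h₄.1))).mono (by decide)
    refine ⟨?_, ?_, ?_, h₄.2, ?_⟩
    · rw [h.matrixAt_eq (by decide), hρ.matrix]
    · rw [h 1 (by decide), hρ.exponent]
    · rw [h 12 (by decide), hρ.factor]
    · rw [(h₃.1.trans h₄.1).vectorAt_eq (by decide), h₂.2]
  · have := hν.pow_mul_pow_le (a := 1) (b := 0) (by simp) (by simp)
    simp only [RExp.cost, NExp.cost]
    linarith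

/-- From the weights accumulated in `T` iterations, where `T` is in register `7`, to the output. -/
def outputProgram : Program :=
  fillVector 10 0 (coord 11 2 /ᵣ .ofNat (.reg 7)) ;;
  leverageProgram ;;
  fillVector 3 0 (coord 9 2 ^ᵣ (scalar 1 /ᵣ .const 2))

theorem computes_outputProgram (hν : Ready n d ν) (h5 : ν 5 = 0) (h7 : ν 7 = T) (hT : 0 < T)
    (hA : Function.Injective A.mulVec) (hρ : LoopInvariant A p κ T ρ) :
    Computes outputProgram (500 * (n * d ^ 3)) ν ρ fun ρ' =>
      (vectorAt ρ' 3 n = fun i =>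
        (A i ⬝ᵥ (scaledGram A (averageWeight A p T))⁻¹ *ᵥ A i) ^ (p / 2)) ∧
      matrixAt ρ' 4 d d = (scaledGram A (averageWeight A p T))⁻¹ := by
  have hX := scaledGram_averageWeight_posDef (p := p) hA hν.cols_pos hT
  refine Computes.mono (Computes.seq (Computes.fillVector hν hν.rows hν.rows_pos
    (averageWeight A p T) fun i ρ' h' _ => ?_) fun ρ₁ h₁ => Computes.seq
    (computes_leverageProgram hν h5 ((h₁.1.matrixAt_eq (by decide) _ _).trans hρ.matrix) h₁.2 hX)
    fun ρ₂ h₂ => Computes.mono (Computes.fillVector hν hν.rows hν.rows_pos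
      (fun i => (A i ⬝ᵥ (scaledGram A (averageWeight A p T))⁻¹ *ᵥ A i) ^ (p / 2))
      fun i ρ' h' _ => ?_) le_rfl fun ρ₃ h₃ => ⟨h₃.2, ?_⟩) ?_ fun _ h => h
  · have hs : ρ 11 i 0 = ∑ m ∈ Finset.range T, lewisIter A p m i ^ (1 - 2 / p) :=
      congrFun hρ.total i
    simp [RExp.eval, NExp.eval, h' 11, hs, h7, averageWeight, ← Finset.mul_sum, div_eq_inv_mul]
  · have hq : ρ₂ 9 i 0 = A i ⬝ᵥ (scaledGram A (averageWeight A p T))⁻¹ *ᵥ A i :=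
      congrFun h₂.2.2 i
    simp [RExp.eval, NExp.eval, h' 1, h' 9, h₂.1 1, h₁.1 1, hρ.exponent, hq,
      (quad_nonneg hX.inv.posSemidef (A i)).not_gt]
  · have := hν.pow_mul_pow_le (a := 1) (b := 0) (by simp) (by simp)
    simp only [RExp.cost, NExp.cost]
    linarith
  · rw [h₃.1.matrixAt_eq (by decide), h₂.2.1]

/-- Uniform initial weights, and the iteration factor. -/
def initProgram : Program :=
  fillVector 3 0 (.ofNat (.reg 1) /ᵣ .ofNat (.reg 0)) ;;
  .setReal 12 (.const 0) (.const 0)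
    (.const 1 +ᵣ .const 2 /ᵣ ((.const 1 +ᵣ scalar 2) ^ᵣ (.const 2 /ᵣ scalar 1) +ᵣ
      .const 1 /ᵣ (.const 1 +ᵣ scalar 2) ^ᵣ (.const 2 /ᵣ scalar 1) -ᵣ .const 2))

theorem computes_initProgram (A : Matrix (Fin n) (Fin d) ℝ) (p : ℝ) (hε : 0 < ε)
    (hν : Ready n d ν) : Computes initProgram (100 * (n * d ^ 3)) ν (input A p ε).real
      (LoopInvariant A p (iterationFactor p ε) 0) := by
  have hε' : 0 ≤ 1 + ε := by linarith
  refine Computes.mono (Computes.seq (Computes.fillVector hν hν.rows hν.rows_pos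
    (lewisIter A p 0) fun i ρ' _ _ => ?_) fun ρ₁ h₁ => Computes.setReal.mono le_rfl ?_) ?_
    fun _ h => h
  · simp [RExp.eval, NExp.eval, hν.rows, hν.cols, lewisIter]
  · rintro _ rfl
    have hput := agreeOff_put ρ₁ 12 0 0
    refine ⟨?_, ?_, ?_, ?_, ?_⟩
    · rw [NExp.eval, (h₁.1.trans (hput _)).matrixAt_eq (by decide)]
      ext i j
      simp [matrixAt, input]
    · rw [NExp.eval, (h₁.1.trans (hput _)) 1 (by decide)]
      simp [input]
    · simp [RExp.eval, NExp.eval, put_self, h₁.1 1, h₁.1 2, input, hε', iterationFactor]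
    · rw [NExp.eval, (hput _).vectorAt_eq (by decide), h₁.2]
    · rw [NExp.eval, (h₁.1.trans (hput _)).vectorAt_eq (by decide)]
      ext i
      simp [vectorAt, input]
  · have h0 := hν.pow_mul_pow_le (a := 0) (b := 0) (by simp) (by simp)
    have h1 := hν.pow_mul_pow_le (a := 1) (b := 0) (by simp) (by simp)
    simp only [RExp.cost, NExp.cost]
    linarith

/-- The registers outside the bodies of the `for` loops: besides the dimensions, register `6` holds
the binary logarithm `L` and register `7` the number `k` of iterations done. -/
structure Registers (n d L k : ℕ) (ν : ℕ → ℕ) : Prop extends Ready n d ν where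
  pivot : ν 5 = 0
  log : ν 6 = L
  count : ν 7 = k

/-- Doubles register `8` until it is at least `n`, counting the doublings in register `6`. -/
def logLoop : Program :=
  .loop (.neg (.natLe (.reg 0) (.reg 8)))
    (.setNat 8 (.add (.reg 8) (.reg 8)) ;; .setNat 6 (.add (.reg 6) (.const 1)))

theorem haltsWithin_logLoop (hν : Registers n d 0 0 ν) (h8 : ν 8 = 1) :
    HaltsWithin logLoop (13 * Nat.clog 2 n + 5) ⟨ν, ρ⟩ fun τ =>
      Registers n d (Nat.clog 2 n) 0 τ.nat ∧ τ.real = ρ := by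
  refine (HaltsWithin.loop (c := 8) (N := Nat.clog 2 n) (fun k τ =>
    (Registers n d k 0 τ.nat ∧ τ.nat 8 = 2 ^ k) ∧ τ.real = ρ) ?_ ?_ ⟨⟨hν, h8⟩, rfl⟩).mono ?_
    fun τ h => ⟨h.1.1, h.2⟩
  · rintro k hk ⟨ν, _⟩ ⟨⟨(hν : Registers n d k 0 ν), (h8 : ν 8 = 2 ^ k)⟩, rfl⟩
    refine ⟨?_, (HaltsWithin.seq HaltsWithin.setNat fun τ hτ => HaltsWithin.setNat.mono le_rfl
      ?_).mono le_rfl fun _ h => h⟩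
    · simpa [BExp.eval, NExp.eval, hν.rows, h8] using (Nat.lt_clog_iff_pow_lt (by decide)).mp hk
    · subst hτ
      rintro _ rfl
      refine ⟨⟨⟨(hν.toReady.update (by simp) _).update (by simp) _, ?_, ?_, ?_⟩, ?_⟩, rfl⟩ <;>
        simp [State.setNat, NExp.eval, hν.pivot, hν.log, hν.count, h8, pow_succ, mul_two]
  · rintro ⟨ν, _⟩ ⟨⟨(hν : Registers n d _ 0 ν), (h8 : ν 8 = 2 ^ Nat.clog 2 n)⟩, -⟩
    simpa [BExp.eval, NExp.eval, hν.rows, h8] using Nat.le_pow_clog (by decide) n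
  · simp only [BExp.cost, NExp.cost]
    omega

/-- Register `6` becomes the least `L` with `n ≤ 2 ^ L`. -/
def logProgram : Program :=
  .setNat 8 (.const 1) ;; logLoop

theorem haltsWithin_logProgram (A : Matrix (Fin n) (Fin d) ℝ) (p ε : ℝ) (hn : 0 < n)
    (hd : 0 < d) : HaltsWithin logProgram (13 * Nat.clog 2 n + 7) (input A p ε) fun τ =>
      Registers n d (Nat.clog 2 n) 0 τ.nat ∧ τ.real = (input A p ε).real := by
  have hstart : Registers n d 0 0 (Function.update (input A p ε).nat 8 1) := by
    refine ⟨⟨hn, hd, ?_, ?_, fun x hx hx' => ?_⟩, ?_, ?_, ?_⟩ <;>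
      simp only [input, Function.update_apply] <;> grind
  refine (HaltsWithin.seq HaltsWithin.setNat ?_ (c₂ := 13 * Nat.clog 2 n + 5)).mono ?_ fun _ h => h
  · rintro _ rfl
    exact haltsWithin_logLoop hstart (Function.update_self ..)
  · simp only [NExp.cost]
    omega

/-- The number of iterations made by the main loop. -/
noncomputable def iterationCount (p ε : ℝ) (n d : ℕ) : ℕ :=
  ⌊iterationFactor p ε * (d * (Nat.clog 2 n + 1 : ℕ))⌋₊ + 1

/-- The main loop; register `7` counts the iterations. -/
def mainLoop : Program :=
  .loop (.realLe (.ofNat (.reg 7))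
      (scalar 12 *ᵣ (.ofNat (.reg 1) *ᵣ .ofNat (.add (.reg 6) (.const 1)))))
    (iterationProgram ;; .setNat 7 (.add (.reg 7) (.const 1)))

theorem haltsWithin_mainLoop (hA : Function.Injective A.mulVec) (hκ : 0 ≤ iterationFactor p ε)
    (hν : Registers n d (Nat.clog 2 n) 0 ν) (hρ : LoopInvariant A p (iterationFactor p ε) 0 ρ) :
    HaltsWithin mainLoop (iterationCount p ε n d * (520 * (n * d ^ 3)) + 16) ⟨ν, ρ⟩ fun τ =>
      Registers n d (Nat.clog 2 n) (iterationCount p ε n d) τ.nat ∧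
        LoopInvariant A p (iterationFactor p ε) (iterationCount p ε n d) τ.real := by
  have hX : 1 ≤ n * d ^ 3 := hν.pow_mul_pow_le (a := 0) (b := 0) (by simp) (by simp)
  refine (HaltsWithin.loop (N := iterationCount p ε n d) (c := 500 * (n * d ^ 3) + 4)
    (fun k τ => Registers n d (Nat.clog 2 n) k τ.nat ∧
      LoopInvariant A p (iterationFactor p ε) k τ.real) ?_ ?_ ⟨hν, hρ⟩).mono ?_ fun _ h => h
  · rintro k hk ⟨ν, ρ⟩ ⟨(hν : Registers n d _ k ν), (hρ : LoopInvariant A p _ k ρ)⟩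
    refine ⟨?_, HaltsWithin.seq (computes_iterationProgram hν.toReady hν.pivot hA hρ) ?_⟩
    · have := (Nat.le_floor_iff (by positivity)).mp (Nat.lt_succ_iff.mp hk)
      simpa [BExp.eval, RExp.eval, NExp.eval, hν.log, hν.count, hν.cols, hρ.factor] using this
    · rintro ⟨ν', ρ'⟩ ⟨(rfl : ν' = ν), hρ'⟩
      refine HaltsWithin.setNat.mono le_rfl ?_
      rintro _ rfl
      refine ⟨⟨hν.toReady.update (by simp) _, ?_, ?_, ?_⟩, hρ'⟩ <;>
        simp [State.setNat, hν.pivot, hν.log, hν.count, NExp.eval]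
  · rintro ⟨ν, ρ⟩ ⟨(hν : Registers n d _ _ ν), (hρ : LoopInvariant A p _ _ ρ)⟩
    have := Nat.lt_floor_add_one (iterationFactor p ε * (d * (Nat.clog 2 n + 1 : ℕ)))
    simpa [BExp.eval, RExp.eval, NExp.eval, hν.log, hν.count, hν.cols, hρ.factor,
      iterationCount] using this
  · simp only [BExp.cost, RExp.cost, NExp.cost]
    exact Nat.add_le_add (Nat.mul_le_mul_left _ (by omega)) (by norm_num)

theorem clog_lt_iterationCount (hp : 0 < p) (hε : 0 < ε) (hd : 0 < d) :
    Nat.clog 2 n < iterationCount p ε n d := by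
  have hκ := one_le_iterationFactor hp hε
  have hd1 : (1 : ℝ) ≤ d := by exact_mod_cast hd
  have hL : (0 : ℝ) ≤ (Nat.clog 2 n + 1 : ℕ) := Nat.cast_nonneg _
  refine (Nat.le_floor ?_).trans (Nat.le_succ _)
  exact (le_mul_of_one_le_left hL hd1).trans (le_mul_of_one_le_left (by positivity) hκ)

/-- The program computing approximate Lewis weights and an approximate Lewis quadratic form. -/
def lewisProgram : Program :=
  logProgram ;; initProgram ;; mainLoop ;; outputProgram

theorem haltsWithin_lewisProgram (hA : Function.Injective A.mulVec) (hd : 0 < d) (hp : 0 < p)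
    (hε : 0 < ε) (hT : T = iterationCount p ε n d) :
    HaltsWithin lewisProgram (T * (1200 * (n * d ^ 3))) (input A p ε) fun τ =>
      (outputVector τ n = fun i =>
        (A i ⬝ᵥ (scaledGram A (averageWeight A p T))⁻¹ *ᵥ A i) ^ (p / 2)) ∧
      outputMatrix τ d = (scaledGram A (averageWeight A p T))⁻¹ := by
  have hn := pos_of_mulVec_injective hA hd
  have hκ : 0 ≤ iterationFactor p ε := zero_le_one.trans (one_le_iterationFactor hp hε)
  have hclog : Nat.clog 2 n < T := hT ▸ clog_lt_iterationCount hp hε hd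
  refine (HaltsWithin.seq (haltsWithin_logProgram A p ε hn hd) ?_
    (c₂ := 100 * (n * d ^ 3) + (T * (520 * (n * d ^ 3)) + 16 + 500 * (n * d ^ 3)))).mono ?_
    fun _ h => h
  · rintro ⟨ν, _⟩ ⟨(hν : Registers n d _ 0 ν), rfl⟩
    refine HaltsWithin.seq (computes_initProgram A p hε hν.toReady) ?_
    rintro ⟨_, ρ⟩ ⟨rfl, hρ⟩
    refine hT ▸ HaltsWithin.seq (haltsWithin_mainLoop hA hκ hν hρ) ?_
    rintro ⟨ν', ρ'⟩ ⟨hν', hρ'⟩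
    exact HaltsWithin.mono (computes_outputProgram hν'.toReady hν'.pivot hν'.count (by omega) hA
      hρ') le_rfl fun _ h => h.2
  · have hX : 1 ≤ n * d ^ 3 := Nat.mul_pos hn (Nat.pow_pos hd)
    nlinarith [Nat.mul_le_mul hclog hX]

theorem clog_two_eq_ceil_logb (n : ℕ) : Nat.clog 2 n = ⌈Real.logb 2 n⌉₊ := by
  exact_mod_cast (Real.natCeil_logb_natCast 2 n).symm

theorem clog_add_one_le (n : ℕ) : (Nat.clog 2 n : ℝ) + 1 ≤ 4 * max 1 (Real.log n) := by
  have hlogb : Real.logb 2 n ≤ 2 * Real.log n := by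
    rw [Real.logb, div_le_iff₀ (Real.log_pos one_lt_two)]
    nlinarith [Real.log_natCast_nonneg n, Real.log_two_gt_d9]
  have hlogb0 : 0 ≤ Real.logb 2 n :=
    div_nonneg (Real.log_natCast_nonneg n) (Real.log_pos one_lt_two).le
  rw [clog_two_eq_ceil_logb]
  linarith [Nat.ceil_lt_add_one hlogb0, le_max_left 1 (Real.log n), le_max_right 1 (Real.log n)]

theorem log_le_clog (n : ℕ) : Real.log n ≤ Nat.clog 2 n := by
  have hlogb : Real.log n ≤ Real.logb 2 n := by
    rw [Real.logb, le_div_iff₀ (Real.log_pos one_lt_two)]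
    nlinarith [Real.log_natCast_nonneg n, Real.log_two_lt_d9]
  rw [clog_two_eq_ceil_logb]
  exact hlogb.trans (Nat.le_ceil _)

theorem le_iterationCount (hp : 0 < p) (hε : 0 < ε) (n d : ℕ) :
    iterationFactor p ε * (d * Real.log n) ≤ iterationCount p ε n d := by
  have hκ := one_le_iterationFactor hp hε
  calc
    iterationFactor p ε * (d * Real.log n)
      ≤ iterationFactor p ε * (d * (Nat.clog 2 n + 1 : ℕ)) := by
        push_cast
        gcongr
        exact (log_le_clog n).trans (le_add_of_nonneg_right zero_le_one)
    _ ≤ iterationCount p ε n d := (Nat.lt_succ_floor _).le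

theorem iterationCount_le (hp : 0 < p) (hε : 0 < ε) (hd : 0 < d) (n : ℕ) :
    (iterationCount p ε n d : ℝ) ≤ 8 * iterationFactor p ε * d * max 1 (Real.log n) := by
  have hκ := one_le_iterationFactor hp hε
  have hd1 : (1 : ℝ) ≤ d := by exact_mod_cast hd
  have hfloor := Nat.floor_le (a := iterationFactor p ε * (d * (Nat.clog 2 n + 1 : ℕ)))
    (by positivity)
  have hone : 1 ≤ iterationFactor p ε * (d * (Nat.clog 2 n + 1 : ℕ)) :=
    one_le_mul_of_one_le_of_one_le hκ (one_le_mul_of_one_le_of_one_le hd1 (by simp))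
  calc
    (iterationCount p ε n d : ℝ) ≤ 2 * (iterationFactor p ε * (d * (Nat.clog 2 n + 1 : ℕ))) := by
        rw [iterationCount, Nat.cast_add_one]
        linarith
    _ ≤ 2 * (iterationFactor p ε * (d * (4 * max 1 (Real.log n)))) := by
        push_cast
        gcongr
        exact clog_add_one_le n
    _ = 8 * iterationFactor p ε * d * max 1 (Real.log n) := by ring

theorem iterationCount_mul_le (hp : 0 < p) (hε : 0 < ε) (hd : 0 < d) (n : ℕ) :
    ((iterationCount p ε n d * (1200 * (n * d ^ 3)) : ℕ) : ℝ) ≤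
      9600 * iterationFactor p ε *
        (n * max 1 (Real.log n) * max 1 (Real.log (Real.log n)) * (d : ℝ) ^ 4) := by
  have hκ := one_le_iterationFactor hp hε
  calc
    ((iterationCount p ε n d * (1200 * (n * d ^ 3)) : ℕ) : ℝ)
      ≤ 8 * iterationFactor p ε * d * max 1 (Real.log n) * (1200 * (n * d ^ 3)) := by
        push_cast
        gcongr
        exact iterationCount_le hp hε hd n
    _ = 9600 * iterationFactor p ε * (n * max 1 (Real.log n) * 1 * (d : ℝ) ^ 4) := by ring
    _ ≤ _ := by
        gcongr
        exact le_max_left _ _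

end Lewis

end RealRAM

theorem theorem4p4 :
    ∃ (f : ℝ → ℝ → ℝ) (C : ℕ) (P : RealRAM.Program),
      ∀ (p ε : ℝ), 2 ≤ p → 0 < ε →
      ∀ (n d : ℕ) (A : Matrix (Fin n) (Fin d) ℝ), 0 < d → A.rank = d →
        ∃ (t : ℕ) (τ : RealRAM.State),
          RealRAM.Runs P (RealRAM.input A p ε) t τ ∧
          (t : ℝ) ≤ f p ε * ((n : ℝ) * max 1 (Real.log n) * max 1 (Real.log (Real.log n)) *
            (d : ℝ) ^ C) ∧
          (∃ wbar : Fin n → ℝ,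
            (∀ w, LewisWeights.IsLewisWeights A p w ↔ w = wbar) ∧
            ∀ i, LewisWeights.Approx (1 + ε) (RealRAM.outputVector τ n i) (wbar i)) ∧
          (∃ Q : Matrix (Fin d) (Fin d) ℝ,
            (∀ M, LewisWeights.IsLewisForm A p M ↔ M = Q) ∧
            LewisWeights.LoewnerApprox (1 + ε) (RealRAM.outputMatrix τ d) Q) := by
  refine ⟨fun p ε => 9600 * LewisWeights.iterationFactor p ε, 4, RealRAM.lewisProgram,
    fun p ε hp hε n d A hd hrank => ?_⟩
  have hp0 : 0 < p := by linarith
  have hA := LewisWeights.mulVec_injective_of_rank_eq hrank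
  obtain ⟨w, hw, hQ⟩ := LewisWeights.exists_isLewisWeights_isLewisForm hA hd hp
  have hT : 0 < RealRAM.iterationCount p ε n d := Nat.succ_pos _
  have hlog := RealRAM.le_iterationCount hp0 hε n d
  obtain ⟨t, τ, ht, hrun, hv, hM⟩ := RealRAM.haltsWithin_lewisProgram hA hd hp0 hε rfl
  refine ⟨t, τ, hrun, ?_, ⟨w, fun w' => ⟨fun h => h.eq hw hp, fun h => h ▸ hw⟩, fun i => ?_⟩,
    _, fun Q => ⟨fun h => h.eq_inv hw hd hp, fun h => h ▸ hQ⟩, ?_⟩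
  · exact (Nat.cast_le.mpr ht).trans (RealRAM.iterationCount_mul_le hp0 hε hd n)
  · rw [hv]
    exact LewisWeights.approx_rpow_quad_averageWeight hA hd hp hε hT hlog hw i
  · rw [hM]
    exact LewisWeights.loewnerApprox_averageWeight hA hd hp hε hT hlog hw
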